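/- Let $n\ge 0$, $d=2^n$, and let $P_1,\dots,P_{d^2-1}$ be the $n$-qubit Pauli operators $\{\mathbb 1,\sigma_x,\sigma_y,\sigma_z\}^{\otimes n}$ other than the identity. Consider estimation at $\theta=0$ of all the parameters $\theta\in\mathbb R^{d^2-1}$ of $$U_\theta=\exp\Big(-i\sum_{k=1}^{d^2-1}\theta_kP_k\Big).$$ A protocol is a discrete ensemble $E=\{p^{(i)},\psi^{(i)},M^{(i)}\}_i$: with probability $p^{(i)}$ the pure state $\psi^{(i)}$ of the $n$ probe qubits and an ancilla of arbitrary finite dimension is prepared, $U_\theta$ acts on the probe, and the POVM $M^{(i)}=\{M^{(i)}_x\}_x$ (with discrete outcomes) is performed on probe and ancilla. The outcome $(i,x)$ has probability $p_{i,x}(\theta)=p^{(i)}\,\mathrm{Tr}\big(\psi^{(i)}_\theta M^{(i)}_x\big)$, where $\psi^{(i)}_\theta=(U_\theta\otimes\mathbb 1)\,|\psi^{(i)}\rangle\langle\psi^{(i)}|\,(U_\theta\otimes\mathbb 1)^\dagger$. The classical Fisher information matrix at $\theta=0$ is $$I(E)_{jk}=\sum_{(i,x):\,p_{i,x}\ne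 0}\frac{\partial_jp_{i,x}\,\partial_kp_{i,x}}{p_{i,x}}\Big|_{\theta=0}.$$ The figure of merit is $\mathrm{Tr}(I(E)^{-1})$ (the weighted mean squared error with cost matrix $W=\mathbb 1$), and $$w=\inf\{\mathrm{Tr}(I(E)^{-1}) : E \text{ a protocol with } I(E)\text{ positive definite}\}.$$ A POVM $M$ on $\mathbb C^D$ is given by a $3$-design if $M_s=q_sD\,|s\rangle\langle s|$ with $q_s>0$, unit vectors $|s\rangle$, and $\sum_sq_s(|s\rangle\langle s|)^{\otimes3}=\int(|\psi\rangle\langle\psi|)^{\otimes3}\,d\psi$, where $d\psi$ is the normalized Haar measure on pure states. (1) Let $E$ consist of the single input $\frac1{\sqrt d}\sum_{k=0}^{d-1}|k\rangle|k\rangle$ on the probe and an ancilla of dimension $d$, measured by any POVM on $\mathbb C^d\otimes\mathbb C^d$ given by a $3$-design. Then $I(E)$ is positive definite and $\mathrm{Tr}(I(E)^{-1})\le 4w$. (2) Let $E$ consist of the inputs $U|0^n\rangle$ without ancilla, with $U$ uniformly random in the (finite) $n$-qubit Clifford group modulo global phases, each measured by the same POVM on $\mathbb C^d$, which may be any POVM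 given by a $3$-design. Then $I(E)$ is positive definite and $\mathrm{Tr}(I(E)^{-1})\le\frac{4(d+1)}{d}\,w$. -/

import Mathlib

open scoped Kronecker ComplexOrder

noncomputable section

namespace HamEst

/-- Computational basis labels of `n` qubits (the Hilbert space has dimension `d = 2 ^ n`). -/
abbrev Qubits (n : ℕ) : Type := Fin n → Fin 2

/-- Labels of the `n`-qubit Pauli operators; `0` labels the identity. -/
abbrev PauliString (n : ℕ) : Type := Fin n → Fin 4

/-- Labels of the `d ^ 2 - 1` unknown parameters: the Pauli operators other than the identity. -/
abbrev Par (n : ℕ) : Type := {P : PauliString n // P ≠ 0}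

/-- The matrices `1, σ_x, σ_y, σ_z`. -/
def sigma : Fin 4 → Matrix (Fin 2) (Fin 2) ℂ :=
  ![1, !![0, 1; 1, 0], !![0, -Complex.I; Complex.I, 0], !![1, 0; 0, -1]]

/-- The tensor product `σ_{P 0} ⊗ ⋯ ⊗ σ_{P (n-1)}`. -/
def pauli {n : ℕ} (P : PauliString n) : Matrix (Qubits n) (Qubits n) ℂ :=
  Matrix.of fun x y => ∏ i, sigma (P i) (x i) (y i)

/-- `U_θ = exp (-i ∑ₖ θₖ Pₖ)`. -/
def evol {n : ℕ} (θ : Par n → ℝ) : Matrix (Qubits n) (Qubits n) ℂ :=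
  NormedSpace.exp (-Complex.I • ∑ k : Par n, (θ k : ℂ) • pauli k.1)

/-- `|v⟩⟨v|`. -/
def ketbra {S : Type} (v : S → ℂ) : Matrix S S ℂ := Matrix.vecMulVec v (star v)

/-- A POVM on `ℂ^S` with (finitely or infinitely many) discrete outcomes `X`. -/
structure POVM (S X : Type) [Fintype S] [DecidableEq S] where
  elem : X → Matrix S S ℂ
  posSemidef : ∀ x, (elem x).PosSemidef
  hasSum_elem : HasSum elem 1

/-- A POVM on `ℂ^S`, regarded as a POVM on `ℂ^S ⊗ ℂ` (trivial ancilla). -/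
def POVM.withTrivialAncilla {S X : Type} [Fintype S] [DecidableEq S] (M : POVM S X) :
    POVM (S × Unit) X where
  elem x := (M.elem x).submatrix Prod.fst Prod.fst
  posSemidef x := (M.posSemidef x).submatrix Prod.fst
  hasSum_elem := by
    let g : Matrix S S ℂ →+ Matrix (S × Unit) (S × Unit) ℂ :=
      { toFun := fun A => A.submatrix Prod.fst Prod.fst
        map_zero' := rfl
        map_add' := fun _ _ => rfl }
    have hg : Continuous g := continuous_id.matrix_submatrix Prod.fst Prod.fst
    have e : g 1 = 1 := by
      ext a b
      change (1 : Matrix S S ℂ) a.1 b.1 = (1 : Matrix (S × Unit) (S × Unit) ℂ) a b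
      simp [Matrix.one_apply, Prod.ext_iff]
    have h := M.hasSum_elem.map g hg
    rw [e] at h
    exact h

/-- `(|v⟩⟨v|)^{⊗ 3}`. -/
def ketbraCube {S : Type} (v : S → ℂ) : Matrix (S × S × S) (S × S × S) ℂ :=
  ketbra v ⊗ₖ (ketbra v ⊗ₖ ketbra v)

/-- Entry of `∫ (|ψ⟩⟨ψ|)^{⊗ 3} dψ`, where `dψ` is the uniform probability measure on unit
vectors (the normalized surface measure of the unit sphere of `ℂ^S`). The integrand does not
depend on the phase of `ψ`, so this is the integral over the complex projective Haar measure. -/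
def haarCube {S : Type} [Fintype S] (a b : S × S × S) : ℂ :=
  ⨍ ψ : Metric.sphere (0 : EuclideanSpace ℂ S) 1,
    ketbraCube (WithLp.ofLp (ψ : EuclideanSpace ℂ S)) a b
      ∂(MeasureTheory.Measure.toSphere
        (MeasureTheory.volume : MeasureTheory.Measure (EuclideanSpace ℂ S)))

/-- `M` is given by a (complex projective) `3`-design: `M_s = q_s d |s⟩⟨s|` with `q_s > 0`, unit
vectors `|s⟩` and `∑ₛ q_s (|s⟩⟨s|)^{⊗ 3} = ∫ (|ψ⟩⟨ψ|)^{⊗ 3} dψ`. -/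
def POVM.IsThreeDesign {S X : Type} [Fintype S] [DecidableEq S] (M : POVM S X) : Prop :=
  ∃ (q : X → ℝ) (v : X → S → ℂ),
    (∀ s, 0 < q s) ∧ (∀ s, star (v s) ⬝ᵥ v s = 1) ∧
    (∀ s, M.elem s = ((q s * Fintype.card S : ℝ) : ℂ) • ketbra (v s)) ∧
    ∀ a b, HasSum (fun s => (q s : ℂ) * ketbraCube (v s) a b) (haarCube a b)

/-- The classical Fisher information matrix at `θ` of a parameterized discrete distribution
`p θ`. -/
def fisherInfo {K X : Type} [DecidableEq K] (p : (K → ℝ) → X → ℝ) (θ : K → ℝ) : Matrix K K ℝ :=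
  Matrix.of fun j k => ∑' x, if p θ x = 0 then 0 else
    lineDeriv ℝ (fun t => p t x) θ (Pi.single j 1) *
      lineDeriv ℝ (fun t => p t x) θ (Pi.single k 1) / p θ x

/-- An ensemble `{p⁽ⁱ⁾, ψ⁽ⁱ⁾, M⁽ⁱ⁾}` of pure input states and measurements. The `i`-th input lives
on the `n` probe qubits together with an ancilla `ℂ^(A i)` of arbitrary finite dimension. -/
structure Protocol (n : ℕ) where
  ι : Type
  p : ι → ℝ
  p_nonneg : ∀ i, 0 ≤ p i
  hasSum_p : HasSum p 1
  A : ι → Type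
  [fintypeA : ∀ i, Fintype (A i)]
  [decEqA : ∀ i, DecidableEq (A i)]
  ψ : ∀ i, Qubits n × A i → ℂ
  ψ_unit : ∀ i, star (ψ i) ⬝ᵥ ψ i = 1
  X : ι → Type
  M : ∀ i, POVM (Qubits n × A i) (X i)

attribute [instance] Protocol.fintypeA Protocol.decEqA

/-- Output state `(U_θ ⊗ 1) |ψ⟩⟨ψ| (U_θ ⊗ 1)†`. -/
def outState {n : ℕ} {A : Type} [Fintype A] [DecidableEq A] (ψ : Qubits n × A → ℂ)
    (θ : Par n → ℝ) : Matrix (Qubits n × A) (Qubits n × A) ℂ :=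
  (evol θ ⊗ₖ (1 : Matrix A A ℂ)) * ketbra ψ * (evol θ ⊗ₖ (1 : Matrix A A ℂ)).conjTranspose

/-- Probability that input `i` is drawn and outcome `x` is observed: `p⁽ⁱ⁾ Tr (ψ⁽ⁱ⁾_θ M⁽ⁱ⁾_x)`. -/
def Protocol.prob {n : ℕ} (E : Protocol n) (θ : Par n → ℝ) (z : Σ i, E.X i) : ℝ :=
  E.p z.1 * (Matrix.trace (outState (E.ψ z.1) θ * (E.M z.1).elem z.2)).re

/-- The classical Fisher information matrix of a protocol at `θ = 0`. -/
def Protocol.cfim {n : ℕ} (E : Protocol n) : Matrix (Par n) (Par n) ℝ :=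
  fisherInfo E.prob 0

/-- The figure of merit `Tr (I⁻¹)` (weighted mean squared error for `W = 1`); meaningful when the
Fisher information matrix is positive definite. -/
def Protocol.wmse {n : ℕ} (E : Protocol n) : ℝ := Matrix.trace (E.cfim)⁻¹

/-- The optimum `w` over all protocols with positive definite Fisher information matrix. -/
def optimalWMSE (n : ℕ) : ℝ :=
  sInf {w : ℝ | ∃ E : Protocol n, E.cfim.PosDef ∧ E.wmse = w}

/-- The maximally entangled state `d^{-1/2} ∑ₖ |k⟩|k⟩`. -/
def meState (n : ℕ) : Qubits n × Qubits n → ℂ :=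
  fun z => if z.1 = z.2 then ((Real.sqrt (2 ^ n))⁻¹ : ℝ) else 0

theorem meState_unit (n : ℕ) : star (meState n) ⬝ᵥ meState n = 1 := by
  have h : (Real.sqrt (2 ^ n))⁻¹ * (Real.sqrt (2 ^ n))⁻¹ = ((2 : ℝ) ^ n)⁻¹ := by
    rw [← mul_inv, Real.mul_self_sqrt (by positivity)]
  have h' : (((Real.sqrt (2 ^ n))⁻¹ : ℝ) : ℂ) * (((Real.sqrt (2 ^ n))⁻¹ : ℝ) : ℂ)
      = ((2 : ℂ) ^ n)⁻¹ := by
    rw [← Complex.ofReal_mul, h]; push_cast; rfl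
  have e : ∀ x y : Qubits n, star (meState n) (x, y) * meState n (x, y)
      = if x = y then ((2 : ℂ) ^ n)⁻¹ else 0 := by
    intro x y
    by_cases hxy : x = y
    · simp only [Pi.star_apply, meState, hxy, if_true, RCLike.star_def, Complex.conj_ofReal, h']
    · simp [meState, hxy]
  simp only [dotProduct, Fintype.sum_prod_type]
  simp only [Pi.star_apply] at e ⊢
  simp only [e]
  simp

/-- Maximally entangled input together with a measurement `M` on probe and ancilla. -/
def meProtocol (n : ℕ) {X : Type} (M : POVM (Qubits n × Qubits n) X) : Protocol n where
  ι := Unit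
  p _ := 1
  p_nonneg _ := zero_le_one
  hasSum_p := by simp
  A _ := Qubits n
  ψ _ := meState n
  ψ_unit _ := meState_unit n
  X _ := X
  M _ := M

/-- `U` conjugates each Pauli operator `P` to the signed Pauli operator `± Q`, `(±, Q) = f P`. -/
def HasTableau {n : ℕ} (U : Matrix (Qubits n) (Qubits n) ℂ)
    (f : PauliString n → ℤˣ × PauliString n) : Prop :=
  ∀ P, U * pauli P * U.conjTranspose = (((f P).1 : ℤ) : ℂ) • pauli (f P).2

/-- The `n`-qubit Clifford group modulo global phases (a finite set). A Clifford unitary is a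
unitary that conjugates Pauli operators to signed Pauli operators; this action determines it up
to a global phase, since the Pauli operators span all matrices. -/
abbrev Clifford (n : ℕ) : Type :=
  {f : PauliString n → ℤˣ × PauliString n //
    ∃ U ∈ Matrix.unitaryGroup (Qubits n) ℂ, HasTableau U f}

/-- A unitary representing a Clifford element (the global phase is irrelevant). -/
def Clifford.unitary {n : ℕ} (C : Clifford n) : Matrix (Qubits n) (Qubits n) ℂ :=
  C.2.choose

instance Clifford.instFintype (n : ℕ) : Fintype (Clifford n) := Fintype.ofFinite _

instance Clifford.instNonempty (n : ℕ) : Nonempty (Clifford n) :=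
  ⟨⟨fun P => (1, P), 1, one_mem _, fun P => by simp⟩⟩

/-- The stabilizer state `U |0…0⟩`, on the probe with a trivial ancilla. -/
def stabState {n : ℕ} (C : Clifford n) : Qubits n × Unit → ℂ :=
  fun z => (C.unitary.mulVec (Pi.single 0 1)) z.1

theorem stabState_unit {n : ℕ} (C : Clifford n) : star (stabState C) ⬝ᵥ stabState C = 1 := by
  have hU : C.unitary.conjTranspose * C.unitary = 1 :=
    (Matrix.mem_unitaryGroup_iff'.mp C.2.choose_spec.1)
  have e : star (stabState C) ⬝ᵥ stabState C
      = star (C.unitary.mulVec (Pi.single 0 1)) ⬝ᵥ (C.unitary.mulVec (Pi.single 0 1)) := by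
    simp [dotProduct, Fintype.sum_prod_type, stabState]
  rw [e, Matrix.star_mulVec, ← Matrix.dotProduct_mulVec, Matrix.mulVec_mulVec, hU]
  simp

/-- Random stabilizer inputs `U |0…0⟩`, `U` uniform in the Clifford group, with the same
measurement `M` on the probe for every input and no ancilla. -/
def stabProtocol (n : ℕ) {X : Type} (M : POVM (Qubits n) X) : Protocol n where
  ι := Clifford n
  p _ := (Fintype.card (Clifford n) : ℝ)⁻¹
  p_nonneg _ := by positivity
  hasSum_p := by
    have h := hasSum_fintype (fun _ : Clifford n => (Fintype.card (Clifford n) : ℝ)⁻¹)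
    simpa using h
  A _ := Unit
  ψ C := stabState C
  ψ_unit C := stabState_unit C
  X _ := X
  M _ := M.withTrivialAncilla

end HamEst

end

noncomputable section

namespace HamEst

open MeasureTheory Metric
open scoped Pointwise

/-! ### Moments of coordinates on the complex unit sphere, from unitary invariance. -/

section SphereMoments

variable {S : Type} [Fintype S]

/-! Both parts compare a Fisher matrix with a multiple of the identity. Let K = d² - 1 be the number
of parameters. Lower bound on `optimalWMSE`: by Cauchy–Schwarz for each POVM element, the diagonal
entry for a Pauli P is at most 4 times the mean squared norm of the tangent vectors -iPψ, hence at
most 4 because P is unitary (`hasSum_scoreBound`, `scoreGram_diag_le`). A positive definite matrix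
with diagonal at most 4 has inverse of trace at least K/4 (`trace_inv_ge`). Upper bound for a
design: if I(E) ≥ c, then Tr I(E)⁻¹ ≤ K/c, within a factor 4/c of the lower bound
(`wmse_le_of_le_cfim`). To find c, fix v and put H = ∑ vₖ Pₖ. Dividing by outcome probabilities
would leave the polynomials that a design averages correctly, so vᵀIv is bounded below by duality: ∑
s²/p ≥ 2 ∑ s f - ∑ p f² for the score s and any test function f. With f proportional to
Re⟨t|w⟩⟨w|ψ⟩, where t is the part of -iHψ orthogonal to ψ, both sums involve only second and third
moments of the design. Their Haar values follow from unitary invariance and give vᵀIv ≥ the mean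
variance of H in the inputs (`le_cfim_of_design`). It remains to average the variance. In the
maximally entangled state it is |v|², so c = 1. Over stabilizer states, Clifford symmetry makes
expectation values of distinct Paulis uncorrelated and gives all nonidentity ones the same second
moment; purity fixes that moment as 1/(d + 1), so c = d/(d + 1) (`sum_variance_stabState`). -/

theorem map_toSphere_isometry {E : Type*} [NormedAddCommGroup E] [NormedSpace ℝ E]
    [MeasurableSpace E] [BorelSpace E] (μ : Measure E) (U : E ≃ₗᵢ[ℝ] E)
    (hU : MeasurePreserving U μ μ)
    (g : sphere (0 : E) 1 ≃ₜ sphere (0 : E) 1) (hg : ∀ x, (g x : E) = U x) :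
    MeasurePreserving g μ.toSphere μ.toSphere := by
  refine ⟨g.measurable, ?_⟩
  ext s hs
  rw [Measure.map_apply g.measurable hs, Measure.toSphere_apply' _ hs,
    Measure.toSphere_apply' _ (g.measurable hs)]
  congr 1
  -- The sphere measure of a set is a multiple of the volume of the cone over it, and a linear
  -- isometry commutes with forming cones.
  have : Set.Ioo (0 : ℝ) 1 • (Subtype.val '' (g ⁻¹' s)) =
      U ⁻¹' (Set.Ioo (0 : ℝ) 1 • (Subtype.val '' s)) := by
    ext x
    simp only [Set.mem_smul, Set.mem_image, Set.mem_preimage]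
    constructor
    · rintro ⟨t, ht, _, ⟨y, hy, rfl⟩, rfl⟩
      exact ⟨t, ht, g y, ⟨g y, hy, rfl⟩, by rw [hg, map_smul]⟩
    · rintro ⟨t, ht, _, ⟨y, hy, rfl⟩, h⟩
      refine ⟨t, ht, g.symm y, ⟨g.symm y, by simpa using hy, rfl⟩, U.injective ?_⟩
      rw [map_smul, ← hg, g.apply_symm_apply, h]
  rw [this]
  exact hU.measure_preimage_emb U.toHomeomorph.measurableEmbedding _

/-- Average of `F` over the unit sphere of `ℂ^S`. -/
def sphereAvg (F : (S → ℂ) → ℝ) : ℝ :=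
  ⨍ ψ : sphere (0 : EuclideanSpace ℂ S) 1, F (WithLp.ofLp (ψ : EuclideanSpace ℂ S))
    ∂(Measure.toSphere (volume : Measure (EuclideanSpace ℂ S)))

theorem sphereAvg_isometry (U : EuclideanSpace ℂ S ≃ₗᵢ[ℂ] EuclideanSpace ℂ S)
    (F : (S → ℂ) → ℝ) :
    sphereAvg (fun u => F (WithLp.ofLp (U (WithLp.toLp 2 u)))) = sphereAvg F := by
  let V : EuclideanSpace ℂ S ≃ₗᵢ[ℝ] EuclideanSpace ℂ S :=
    { U.toLinearEquiv.restrictScalars ℝ with norm_map' := U.norm_map }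
  let g : sphere (0 : EuclideanSpace ℂ S) 1 ≃ₜ sphere (0 : EuclideanSpace ℂ S) 1 :=
    U.toHomeomorph.subtype (fun x => by simp)
  have h := map_toSphere_isometry (volume : Measure (EuclideanSpace ℂ S)) V
    V.measurePreserving g (fun x => rfl)
  unfold sphereAvg
  rw [average_eq, average_eq]
  congr 1
  exact h.integral_comp g.measurableEmbedding
    (fun ψ => F (WithLp.ofLp (ψ : EuclideanSpace ℂ S)))

theorem sphereAvg_orthonormal (v : S → EuclideanSpace ℂ S) (hv : Orthonormal ℂ v)
    (F : (S → ℂ) → ℝ) :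
    sphereAvg (fun u => F (fun k => inner ℂ (v k) (WithLp.toLp 2 u))) = sphereAvg F := by
  classical
  obtain ⟨b, hb⟩ := Orthonormal.exists_orthonormalBasis_extension_of_card_eq (𝕜 := ℂ)
    (E := EuclideanSpace ℂ S) (ι := S) (by simp) (v := v) (s := Set.univ)
    (hv.comp _ Subtype.val_injective)
  rw [← sphereAvg_isometry b.repr F]
  congr 1
  ext u
  congr 1
  ext k
  rw [b.repr_apply_apply, hb k (Set.mem_univ k)]

theorem sphereAvg_const [Nonempty S] (c : ℝ) : sphereAvg (fun _ : S → ℂ => c) = c := by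
  unfold sphereAvg
  have : NeZero (Measure.toSphere (volume : Measure (EuclideanSpace ℂ S))) :=
    ⟨Measure.toSphere_ne_zero _⟩
  exact average_const _ c

theorem integrable_sphere {E : Type*} [NormedAddCommGroup E] {F : (S → ℂ) → E}
    (hF : Continuous F) :
    Integrable (fun ψ : sphere (0 : EuclideanSpace ℂ S) 1 =>
      F (WithLp.ofLp (ψ : EuclideanSpace ℂ S)))
      (Measure.toSphere (volume : Measure (EuclideanSpace ℂ S))) := by
  refine Continuous.integrable_of_hasCompactSupport (by fun_prop) ?_
  exact HasCompactSupport.of_compactSpace _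

theorem sphereAvg_add {F G : (S → ℂ) → ℝ} (hF : Continuous F) (hG : Continuous G) :
    sphereAvg (fun u => F u + G u) = sphereAvg F + sphereAvg G := by
  unfold sphereAvg
  rw [average_eq, average_eq, average_eq,
    integral_add (integrable_sphere hF) (integrable_sphere hG), smul_add]

theorem sphereAvg_mul_left (c : ℝ) (F : (S → ℂ) → ℝ) :
    sphereAvg (fun u => c * F u) = c * sphereAvg F := by
  unfold sphereAvg
  rw [average_eq, average_eq, integral_const_mul]
  simp only [smul_eq_mul]; ring

theorem sphereAvg_sum {κ : Type*} (s : Finset κ) {F : κ → (S → ℂ) → ℝ}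
    (hF : ∀ k ∈ s, Continuous (F k)) :
    sphereAvg (fun u => ∑ k ∈ s, F k u) = ∑ k ∈ s, sphereAvg (F k) := by
  unfold sphereAvg
  simp only [average_eq]
  rw [integral_finsetSum _ (fun k hk => integrable_sphere (hF k hk)), Finset.smul_sum]

theorem sphereAvg_congr {F G : (S → ℂ) → ℝ}
    (h : ∀ u : S → ℂ, ∑ k, ‖u k‖ ^ 2 = 1 → F u = G u) : sphereAvg F = sphereAvg G := by
  unfold sphereAvg
  congr 1
  ext ψ
  apply h
  have := EuclideanSpace.norm_sq_eq (ψ : EuclideanSpace ℂ S)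
  rw [← this, mem_sphere_zero_iff_norm.mp ψ.2, one_pow]

theorem sphereAvg_swap [DecidableEq S] (i j : S) (F : (S → ℂ) → ℝ) :
    sphereAvg (fun u => F (fun k => u (Equiv.swap i j k))) = sphereAvg F := by
  have h := sphereAvg_orthonormal (fun k => EuclideanSpace.basisFun S ℂ (Equiv.swap i j k))
    ((EuclideanSpace.basisFun S ℂ).orthonormal.comp _ (Equiv.swap i j).injective) F
  rw [← h]
  simp [EuclideanSpace.inner_single_left]

theorem sphereAvg_phase [DecidableEq S] (i : S) (F : (S → ℂ) → ℝ) :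
    sphereAvg (fun u => F (Function.update u i (Complex.I * u i))) = sphereAvg F := by
  have h := sphereAvg_orthonormal (fun k => (if k = i then -Complex.I else 1) •
    EuclideanSpace.basisFun S ℂ k) ?_ F
  · rw [← h]
    congr 1; ext u; congr 1; ext k
    by_cases hk : k = i
    · subst hk; simp [inner_smul_left, EuclideanSpace.inner_single_left]
    · simp [hk, EuclideanSpace.inner_single_left]
  · have hb := orthonormal_iff_ite.mp (EuclideanSpace.basisFun S ℂ).orthonormal
    rw [orthonormal_iff_ite]
    intro k l
    rw [inner_smul_left, inner_smul_right, hb]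
    split_ifs <;> simp_all

theorem orthonormal_rotate {κ E : Type*} [DecidableEq κ] [NormedAddCommGroup E]
    [InnerProductSpace ℂ E] {e : κ → E} (he : Orthonormal ℂ e) {i j : κ} (hij : i ≠ j) (a c : ℂ)
    (ha : star a * a = 1 / 2) (hc : star c * c = 1) :
    Orthonormal ℂ fun k =>
      if k = i then a • e i + (a * c) • e j else if k = j then a • e i - (a * c) • e j
      else e k := by
  rw [orthonormal_iff_ite] at he ⊢
  simp only [RCLike.star_def] at ha hc
  have key : (starRingEnd ℂ) a * (starRingEnd ℂ) c * (a * c) = 1 / 2 := by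
    linear_combination ((starRingEnd ℂ) c * c) * ha + (1 / 2) * hc
  intro k l
  by_cases h1 : k = i
  · subst h1
    by_cases h2 : l = k
    · subst h2
      simp only [if_true, inner_add_left, inner_add_right, inner_smul_left, inner_smul_right, he,
        hij, hij.symm, map_mul, if_false, mul_one, mul_zero]
      linear_combination ha + key
    · by_cases h3 : l = j
      · subst h3
        simp only [if_true, inner_add_left, inner_sub_right, inner_smul_left, inner_smul_right, he,
          hij, hij.symm, map_mul, if_false, mul_one, mul_zero]
        linear_combination ha - key
      · simp [inner_add_left, inner_smul_left, he, Ne.symm h2, h2, h3, Ne.symm h3]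
  · by_cases h1' : k = j
    · subst h1'
      by_cases h2 : l = i
      · subst h2
        simp only [if_true, inner_add_right, inner_sub_left, inner_smul_left, inner_smul_right, he,
          hij, hij.symm, map_mul, if_false, mul_one, mul_zero]
        linear_combination ha - key
      · by_cases h3 : l = k
        · subst h3
          simp only [if_true, inner_sub_left, inner_sub_right, inner_smul_left, inner_smul_right,
            he, hij, hij.symm, map_mul, if_false, mul_one, mul_zero]
          linear_combination ha + key
        · simp [inner_sub_left, inner_smul_left, he, Ne.symm h2, h2, h3, Ne.symm h3, h1]
    · by_cases h2 : l = i
      · subst h2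
        simp [inner_add_right, inner_smul_right, he, h1, h1']
      · by_cases h3 : l = j
        · subst h3
          simp [inner_sub_right, inner_smul_right, he, h1, h1', h2]
        · simp [he, h1, h1', h2, h3]

theorem sphereAvg_rotate [DecidableEq S] {i j : S} (hij : i ≠ j) (a c : ℂ)
    (ha : star a * a = 1 / 2) (hc : star c * c = 1) (F : (S → ℂ) → ℝ) :
    sphereAvg (fun u => F (Function.update (Function.update u i
      (star a * u i + star (a * c) * u j)) j (star a * u i - star (a * c) * u j))) =
      sphereAvg F := by
  have h := sphereAvg_orthonormal _ (orthonormal_rotate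
    (EuclideanSpace.basisFun S ℂ).orthonormal hij a c ha hc) F
  rw [← h]
  congr 1; ext u; congr 1; ext k
  by_cases hk : k = i
  · subst hk
    simp [hij, EuclideanSpace.inner_single_left]
    ring
  · by_cases hk' : k = j
    · subst hk'
      simp [hij.symm, EuclideanSpace.inner_single_left]
      ring
    · simp [hk, hk', EuclideanSpace.inner_single_left]

/-- Rotating coordinates i and j turns |uᵢ|²|uⱼ|² into |uᵢ² - c̄²uⱼ²|²/4. Adding the cases c = 1 and
c = i cancels the cross term and leaves (|uᵢ|⁴ + |uⱼ|⁴)/2; the swap symmetry identifies the two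
fourth powers. The weight g, blind to both coordinates, lets the same relation serve in degree six.
-/
theorem sphereAvg_normSq_sq [DecidableEq S] {i j : S} (hij : i ≠ j) {g : (S → ℂ) → ℝ}
    (hg : Continuous g)
    (hgij : ∀ u x y, g (Function.update (Function.update u i x) j y) = g u) :
    sphereAvg (fun u => g u * Complex.normSq (u i) ^ 2) =
      2 * sphereAvg (fun u => g u * (Complex.normSq (u i) * Complex.normSq (u j))) := by
  have hn : ∀ k : S, Continuous fun u : S → ℂ => Complex.normSq (u k) := fun k =>
    Complex.continuous_normSq.comp (continuous_apply k)
  -- Any a with |a|² = 1/2 would do; this one avoids square roots.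
  have ha : star ((1 + Complex.I) / 2) * ((1 + Complex.I) / 2) = (1 / 2 : ℂ) := by
    apply Complex.ext <;> simp <;> norm_num
  have h1 := sphereAvg_rotate hij _ 1 ha (by simp)
    (fun u => g u * (Complex.normSq (u i) * Complex.normSq (u j)))
  have h2 := sphereAvg_rotate hij _ Complex.I ha (by simp)
    (fun u => g u * (Complex.normSq (u i) * Complex.normSq (u j)))
  have h3 := sphereAvg_swap i j (fun u => g u * Complex.normSq (u i) ^ 2)
  simp only [hgij, Function.update_self, Function.update_of_ne hij] at h1 h2
  have hsw : ∀ u : S → ℂ, (fun k => u (Equiv.swap i j k)) =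
      Function.update (Function.update u i (u j)) j (u i) := by
    intro u; ext k
    by_cases hk : k = j
    · subst hk; simp
    · by_cases hk' : k = i
      · subst hk'; simp [hk]
      · simp [hk, hk', Equiv.swap_apply_of_ne_of_ne]
  simp only [hsw, hgij, Equiv.swap_apply_left] at h3
  have hsum := congrArg₂ (· + ·) h1 h2
  rw [← sphereAvg_add (by fun_prop) (by fun_prop)] at hsum
  have : sphereAvg (fun u => (1 / 2) * (g u * Complex.normSq (u i) ^ 2 +
      g u * Complex.normSq (u j) ^ 2)) = _ := Eq.trans ?_ hsum
  · rw [sphereAvg_mul_left, sphereAvg_add (by fun_prop) (by fun_prop), h3] at this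
    linarith
  · congr 1; ext u
    simp [Complex.normSq_apply]
    ring

/-- The phase change uᵢ ↦ i·uᵢ exchanges the squared real and imaginary parts of uᵢūⱼ, so each has
half the average of |uᵢ|²|uⱼ|². -/
theorem sphereAvg_re_sq [DecidableEq S] {i j : S} (hij : i ≠ j) {g : (S → ℂ) → ℝ}
    (hg : Continuous g)
    (hgi : ∀ u, g (Function.update u i (Complex.I * u i)) = g u) :
    sphereAvg (fun u => g u * (u i * star (u j)).re ^ 2) =
      1 / 2 * sphereAvg (fun u => g u * (Complex.normSq (u i) * Complex.normSq (u j))) := by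
  have h := sphereAvg_phase i (fun u => g u * (u i * star (u j)).re ^ 2)
  simp only [hgi, Function.update_self, Function.update_of_ne hij.symm] at h
  have hsum := congrArg (· + sphereAvg (fun u => g u * (u i * star (u j)).re ^ 2)) h
  rw [← sphereAvg_add (by fun_prop) (by fun_prop)] at hsum
  have : sphereAvg (fun u => g u * (Complex.normSq (u i) * Complex.normSq (u j))) = _ :=
    Eq.trans ?_ hsum
  · linarith
  · congr 1; ext u
    simp [Complex.normSq_apply]
    ring

/-- Inserting 1 = ∑ |uₖ|² links moments of consecutive degrees; the next three averages are computed
from this recursion. -/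
theorem sphereAvg_eq_sum_normSq {F : (S → ℂ) → ℝ} (hF : Continuous F) :
    sphereAvg F = ∑ k, sphereAvg (fun u => F u * Complex.normSq (u k)) := by
  have hn : ∀ k : S, Continuous fun u : S → ℂ => Complex.normSq (u k) := fun k =>
    Complex.continuous_normSq.comp (continuous_apply k)
  rw [← sphereAvg_sum _ (fun k _ => by fun_prop)]
  refine sphereAvg_congr fun u hu => ?_
  simp only [← Finset.mul_sum, Complex.normSq_eq_norm_sq, hu, mul_one]

theorem sphereAvg_normSq [DecidableEq S] (i : S) :
    sphereAvg (fun u : S → ℂ => Complex.normSq (u i)) = 1 / Fintype.card S := by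
  have : Nonempty S := ⟨i⟩
  have h := sphereAvg_eq_sum_normSq (S := S) (continuous_const (y := (1 : ℝ)))
  rw [sphereAvg_const] at h
  have e : ∀ k, sphereAvg (fun u : S → ℂ => 1 * Complex.normSq (u k)) =
      sphereAvg (fun u : S → ℂ => Complex.normSq (u i)) := by
    intro k
    rw [← sphereAvg_swap i k (fun u => Complex.normSq (u i))]
    simp
  simp only [e, Finset.sum_const, Finset.card_univ, nsmul_eq_mul] at h
  field_simp
  linarith

theorem sphereAvg_normSq_mul [DecidableEq S] {i j : S} (hij : i ≠ j) :
    sphereAvg (fun u : S → ℂ => Complex.normSq (u i) * Complex.normSq (u j)) =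
      1 / (Fintype.card S * (Fintype.card S + 1)) := by
  have : Nonempty S := ⟨i⟩
  have hn : ∀ k : S, Continuous fun u : S → ℂ => Complex.normSq (u k) := fun k =>
    Complex.continuous_normSq.comp (continuous_apply k)
  have h := sphereAvg_eq_sum_normSq (hn i)
  rw [sphereAvg_normSq, Finset.sum_eq_add_sum_sdiff_singleton_of_mem (Finset.mem_univ i)] at h
  have h4 := sphereAvg_normSq_sq hij (continuous_const (y := (1 : ℝ))) (fun _ _ _ => rfl)
  simp only [one_mul, pow_two] at h4
  rw [h4, Finset.sum_congr rfl (g := fun _ => sphereAvg (fun u : S → ℂ =>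
    Complex.normSq (u i) * Complex.normSq (u j))) ?_] at h
  · rw [Finset.sum_const, Finset.card_sdiff_of_subset (by simp), Finset.card_univ,
      Finset.card_singleton, nsmul_eq_mul, Nat.cast_sub Fintype.card_pos] at h
    push_cast at h
    have hc : (0 : ℝ) < Fintype.card S := by exact_mod_cast Fintype.card_pos
    field_simp at h ⊢
    linarith
  · intro k hk
    have hki : k ≠ i := by simpa using hk
    rw [← sphereAvg_swap j k]
    simp [Equiv.swap_apply_of_ne_of_ne hij hki.symm]

theorem sphereAvg_normSq_sq_mul [DecidableEq S] {i j : S} (hij : i ≠ j) :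
    sphereAvg (fun u : S → ℂ => Complex.normSq (u j) * (Complex.normSq (u i) *
      Complex.normSq (u j))) =
      2 / (Fintype.card S * (Fintype.card S + 1) * (Fintype.card S + 2)) := by
  have : Nonempty S := ⟨i⟩
  have hn : ∀ k : S, Continuous fun u : S → ℂ => Complex.normSq (u k) := fun k =>
    Complex.continuous_normSq.comp (continuous_apply k)
  have h := sphereAvg_eq_sum_normSq
    (F := fun u : S → ℂ => Complex.normSq (u i) * Complex.normSq (u j)) (by fun_prop)
  set m := sphereAvg (fun u : S → ℂ => Complex.normSq (u j) * (Complex.normSq (u i) *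
      Complex.normSq (u j))) with hm
  rw [sphereAvg_normSq_mul hij,
    Finset.sum_eq_add_sum_sdiff_singleton_of_mem (Finset.mem_univ i),
    Finset.sum_eq_add_sum_sdiff_singleton_of_mem (i := j) (by simp [hij.symm])] at h
  have e1 : sphereAvg (fun u : S → ℂ => Complex.normSq (u i) * Complex.normSq (u j) *
      Complex.normSq (u i)) = m := by
    rw [hm, ← sphereAvg_swap i j]
    congr 1; ext u; simp; ring
  have e2 : sphereAvg (fun u : S → ℂ => Complex.normSq (u i) * Complex.normSq (u j) *
      Complex.normSq (u j)) = m := by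
    rw [hm]; congr 1; ext u; ring
  -- With D coordinates, the terms k = i, j contribute m each and the other D - 2 contribute m/2, so
  -- 1/(D(D + 1)) = m(D + 2)/2.
  rw [e1, e2, Finset.sum_congr rfl (g := fun _ => m / 2) ?_] at h
  · have h2 : 2 ≤ Fintype.card S := Fintype.one_lt_card_iff.mpr ⟨i, j, hij⟩
    rw [Finset.sum_const, Finset.card_sdiff_of_subset (by simp [hij.symm]),
      Finset.card_sdiff_of_subset (by simp), Finset.card_univ,
      Finset.card_singleton, Finset.card_singleton, nsmul_eq_mul, Nat.sub_sub,
      Nat.cast_sub h2] at h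
    push_cast at h
    have hc : (0 : ℝ) < Fintype.card S := by exact_mod_cast Fintype.card_pos
    field_simp at h ⊢
    linarith
  · intro k hk
    have hk' : k ≠ i ∧ k ≠ j := by simpa using hk
    have h4 := sphereAvg_normSq_sq (i := j) (j := k) hk'.2.symm (hn i) (fun u x y => by
      simp [Function.update_of_ne hk'.1.symm, Function.update_of_ne hij])
    have e3 : m = 2 * sphereAvg (fun u : S → ℂ => Complex.normSq (u i) * Complex.normSq (u j) *
      Complex.normSq (u k)) := by
      rw [hm]
      refine Eq.trans ?_ (h4.trans ?_)
      · congr 1; ext u; ring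
      · congr 2; ext u; ring
    linarith

end SphereMoments

/-! ### Transfer of sphere moments to 3-designs. -/

section DesignMoments

variable {S X : Type} [Fintype S]

/-- `q, v` integrates `F` over the unit sphere exactly. -/
def IntegratesExactly (q : X → ℝ) (v : X → S → ℂ) (F : (S → ℂ) → ℝ) : Prop :=
  Continuous F ∧ HasSum (fun s => q s * F (v s)) (sphereAvg F)

theorem IntegratesExactly.add {q : X → ℝ} {v : X → S → ℂ} {F G : (S → ℂ) → ℝ}
    (hF : IntegratesExactly q v F) (hG : IntegratesExactly q v G) :
    IntegratesExactly q v (fun u => F u + G u) := by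
  refine ⟨hF.1.add hG.1, ?_⟩
  rw [sphereAvg_add hF.1 hG.1]
  simpa only [mul_add] using hF.2.add hG.2

theorem IntegratesExactly.sum {κ : Type*} {q : X → ℝ} {v : X → S → ℂ} {F : κ → (S → ℂ) → ℝ}
    (t : Finset κ) (hF : ∀ k ∈ t, IntegratesExactly q v (F k)) :
    IntegratesExactly q v (fun u => ∑ k ∈ t, F k u) := by
  refine ⟨continuous_finsetSum _ fun k hk => (hF k hk).1, ?_⟩
  rw [sphereAvg_sum _ fun k hk => (hF k hk).1]
  simpa only [Finset.mul_sum] using hasSum_sum fun k hk => (hF k hk).2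

theorem continuous_ketbraCube {S : Type} (a b : S × S × S) :
    Continuous fun w : S → ℂ => ketbraCube w a b := by
  simp only [ketbraCube, ketbra, Matrix.kroneckerMap_apply, Matrix.vecMulVec_apply, Pi.star_apply]
  fun_prop

theorem IntegratesExactly.of_threeDesign {q : X → ℝ} {v : X → S → ℂ}
    (h : ∀ a b, HasSum (fun s => (q s : ℂ) * ketbraCube (v s) a b) (haarCube a b))
    (T : S × S × S → S × S × S → ℂ) :
    IntegratesExactly q v (fun w => (∑ a, ∑ b, T a b * ketbraCube w a b).re) := by
  have hc : Continuous fun w : S → ℂ => ∑ a, ∑ b, T a b * ketbraCube w a b :=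
    continuous_finsetSum _ fun a _ => continuous_finsetSum _ fun b _ =>
      continuous_const.mul (continuous_ketbraCube a b)
  refine ⟨Complex.continuous_re.comp hc, ?_⟩
  have h1 : HasSum (fun s => ∑ a, ∑ b, T a b * ((q s : ℂ) * ketbraCube (v s) a b))
      (∑ a, ∑ b, T a b * haarCube a b) :=
    hasSum_sum fun a _ => hasSum_sum fun b _ => (h a b).mul_left _
  have e : sphereAvg (fun w => (∑ a, ∑ b, T a b * ketbraCube w a b).re) =
      (∑ a, ∑ b, T a b * haarCube a b).re := by
    have hi : ∀ a b, Integrable (fun ψ : sphere (0 : EuclideanSpace ℂ S) 1 =>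
        T a b * ketbraCube (WithLp.ofLp (ψ : EuclideanSpace ℂ S)) a b)
        (Measure.toSphere (volume : Measure (EuclideanSpace ℂ S))) := fun a b =>
      integrable_sphere (F := fun w => T a b * ketbraCube w a b)
        (continuous_const.mul (continuous_ketbraCube a b))
    unfold sphereAvg haarCube
    simp only [average_eq]
    have := integral_re (𝕜 := ℂ) (integrable_sphere hc)
    simp only [RCLike.re_to_complex] at this
    rw [this, ← Complex.smul_re,
      integral_finsetSum _ fun a _ => integrable_finsetSum _ fun b _ => hi a b, Finset.smul_sum]
    congr 1
    refine Finset.sum_congr rfl fun a _ => ?_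
    rw [integral_finsetSum _ fun b _ => hi a b, Finset.smul_sum]
    refine Finset.sum_congr rfl fun b _ => ?_
    rw [integral_const_mul, mul_smul_comm]
  rw [e]
  convert Complex.hasSum_re h1 using 2 with s
  rw [← Complex.re_ofReal_mul, Finset.mul_sum]
  congr 1
  refine Finset.sum_congr rfl fun a _ => ?_
  rw [Finset.mul_sum]
  exact Finset.sum_congr rfl fun b _ => by ring

theorem sum_sum_mul_sum_sum {A B : Type*} [Fintype A] [Fintype B] (f : A → A → ℂ)
    (g : B → B → ℂ) :
    (∑ a, ∑ b, f a b) * (∑ a, ∑ b, g a b) =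
      ∑ a : A × B, ∑ b : A × B, f a.1 b.1 * g a.2 b.2 := by
  simp only [Fintype.sum_prod_type, Finset.sum_mul_sum]

/-- `⟨x|w⟩⟨w|y⟩`. -/
def ketbraForm (x y w : S → ℂ) : ℂ := (star x ⬝ᵥ w) * star (star y ⬝ᵥ w)

theorem ketbraForm_eq_sum (x y w : S → ℂ) :
    ketbraForm x y w = ∑ a, ∑ b, star (x a) * y b * ketbra w a b := by
  simp only [ketbraForm, dotProduct, star_sum, star_mul', star_star, Finset.sum_mul_sum, ketbra,
    Matrix.vecMulVec_apply, Pi.star_apply]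
  refine Finset.sum_congr rfl fun a _ => Finset.sum_congr rfl fun b _ => by ring

theorem IntegratesExactly.ketbraForm_mul {q : X → ℝ} {v : X → S → ℂ}
    (h : ∀ a b, HasSum (fun s => (q s : ℂ) * ketbraCube (v s) a b) (haarCube a b))
    (c : ℂ) (x₁ y₁ x₂ y₂ x₃ y₃ : S → ℂ) :
    IntegratesExactly q v (fun w =>
      (c * (ketbraForm x₁ y₁ w * (ketbraForm x₂ y₂ w * ketbraForm x₃ y₃ w))).re) := by
  convert IntegratesExactly.of_threeDesign h (fun a b =>
    c * ((star (x₁ a.1) * y₁ b.1) * ((star (x₂ a.2.1) * y₂ b.2.1) *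
      (star (x₃ a.2.2) * y₃ b.2.2)))) using 3 with w
  rw [ketbraForm_eq_sum x₂, ketbraForm_eq_sum x₃, sum_sum_mul_sum_sum, ketbraForm_eq_sum,
    sum_sum_mul_sum_sum, Finset.mul_sum]
  refine Finset.sum_congr rfl fun a _ => ?_
  rw [Finset.mul_sum]
  refine Finset.sum_congr rfl fun b _ => ?_
  simp only [ketbraCube, Matrix.kroneckerMap_apply]
  ring

/-- An orthonormal pair extends to an orthonormal basis, and unitary invariance turns the pair into
two coordinate directions. -/
theorem sphereAvg_pair [DecidableEq S] {x y : S → ℂ} (hx : star x ⬝ᵥ x = 1)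
    (hy : star y ⬝ᵥ y = 1) (hxy : star x ⬝ᵥ y = 0) :
    ∃ i j : S, i ≠ j ∧ ∀ F : ℂ → ℂ → ℝ,
      sphereAvg (fun u => F (star x ⬝ᵥ u) (star y ⬝ᵥ u)) = sphereAvg (fun u => F (u i) (u j)) := by
  have hin : ∀ a b : S → ℂ, inner ℂ (WithLp.toLp 2 a) (WithLp.toLp 2 b) = star a ⬝ᵥ b := by
    intro a b
    rw [EuclideanSpace.inner_eq_star_dotProduct, dotProduct_comm]
  have hyx : star y ⬝ᵥ x = 0 := by
    rw [← star_eq_zero, ← Matrix.star_dotProduct_star, star_star]; exact hxy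
  have ho : Orthonormal ℂ ![WithLp.toLp 2 x, WithLp.toLp 2 y] := by
    rw [orthonormal_iff_ite]
    intro a b
    fin_cases a <;> fin_cases b <;> simp [hin, hx, hy, hxy, hyx, -inner_self_eq_norm_sq_to_K]
  have hcard := ho.linearIndependent.fintype_card_le_finrank
  simp only [Fintype.card_fin, finrank_euclideanSpace] at hcard
  obtain ⟨i, j, hij⟩ := Fintype.one_lt_card_iff.mp (show 1 < Fintype.card S from hcard)
  obtain ⟨b, hb⟩ := Orthonormal.exists_orthonormalBasis_extension_of_card_eq (𝕜 := ℂ)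
    (E := EuclideanSpace ℂ S) (ι := S) (by simp)
    (v := fun k => if k = i then WithLp.toLp 2 x else WithLp.toLp 2 y) (s := {i, j}) (by
      rw [orthonormal_iff_ite]
      rintro ⟨a, ha⟩ ⟨c, hc⟩
      rcases ha with rfl | rfl <;> rcases hc with rfl | rfl <;>
        simp [Subtype.ext_iff, hij.symm, *, -inner_self_eq_norm_sq_to_K])
  refine ⟨i, j, hij, fun F => ?_⟩
  rw [← sphereAvg_orthonormal b b.orthonormal (fun u => F (u i) (u j))]
  congr 1; ext u
  simp only
  rw [hb i (by simp), hb j (by simp), if_pos rfl, if_neg hij.symm, hin, hin]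

/-- Two tensor factors carry (Re z)² = Re(z² + |z|²)/2 with z = ⟨x|w⟩⟨w|y⟩. The third is traced out,
which contributes 1 on unit vectors; hence the normalization of `v`. -/
theorem integratesExactly_quartic {q : X → ℝ} {v : X → S → ℂ}
    (h : ∀ a b, HasSum (fun s => (q s : ℂ) * ketbraCube (v s) a b) (haarCube a b))
    (hv : ∀ s, star (v s) ⬝ᵥ v s = 1) (x y : S → ℂ) :
    HasSum (fun s => q s * (ketbraForm x y (v s)).re ^ 2)
      (sphereAvg fun w => (ketbraForm x y w).re ^ 2) := by
  classical
  have h1 := IntegratesExactly.sum Finset.univ fun k _ =>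
    (IntegratesExactly.ketbraForm_mul h (1 / 2) x y x y (Pi.single k 1) (Pi.single k 1)).add
    (IntegratesExactly.ketbraForm_mul h (1 / 2) x x y y (Pi.single k 1) (Pi.single k 1))
  have e : ∀ w : S → ℂ, star w ⬝ᵥ w = 1 → (∑ k,
      (((1 / 2 : ℂ) * (ketbraForm x y w * (ketbraForm x y w *
        ketbraForm (Pi.single k 1) (Pi.single k 1) w))).re +
      ((1 / 2 : ℂ) * (ketbraForm x x w * (ketbraForm y y w *
        ketbraForm (Pi.single k 1) (Pi.single k 1) w))).re)) = (ketbraForm x y w).re ^ 2 := by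
    intro w hw
    have hk : ∑ k, ketbraForm (Pi.single k 1) (Pi.single k 1) w = 1 := by
      refine Eq.trans ?_ hw
      rw [dotProduct]
      refine Finset.sum_congr rfl fun k _ => ?_
      simp [ketbraForm, mul_comm]
    simp only [← Complex.add_re, ← Complex.re_sum, Finset.sum_add_distrib, ← Finset.mul_sum, hk]
    simp [ketbraForm]
    ring
  have h2 := h1.2
  rw [sphereAvg_congr (G := fun w => (ketbraForm x y w).re ^ 2)] at h2
  · simpa only [e _ (hv _)] using h2
  · intro u hu
    refine e u ?_
    simp only [dotProduct, Pi.star_apply, RCLike.star_def, Complex.conj_mul']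
    exact_mod_cast hu

theorem integratesExactly_sextic {q : X → ℝ} {v : X → S → ℂ}
    (h : ∀ a b, HasSum (fun s => (q s : ℂ) * ketbraCube (v s) a b) (haarCube a b))
    (x y : S → ℂ) :
    HasSum (fun s => q s * (Complex.normSq (star y ⬝ᵥ v s) * (ketbraForm x y (v s)).re ^ 2))
      (sphereAvg fun w => Complex.normSq (star y ⬝ᵥ w) * (ketbraForm x y w).re ^ 2) := by
  have h1 := (IntegratesExactly.ketbraForm_mul h (1 / 2) x y x y y y).add
    (IntegratesExactly.ketbraForm_mul h (1 / 2) x x y y y y)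
  convert h1.2 using 4 <;>
  · simp [ketbraForm, Complex.normSq_apply]
    ring

/-- Second and third moments of a `3`-design in a pair of orthogonal directions. -/
theorem threeDesign_moments [DecidableEq S] {q : X → ℝ} {v : X → S → ℂ}
    (h : ∀ a b, HasSum (fun s => (q s : ℂ) * ketbraCube (v s) a b) (haarCube a b))
    (hv : ∀ s, star (v s) ⬝ᵥ v s = 1) {x y : S → ℂ} (hy : star y ⬝ᵥ y = 1)
    (hxy : star x ⬝ᵥ y = 0) :
    HasSum (fun s => q s * (ketbraForm x y (v s)).re ^ 2)
      ((star x ⬝ᵥ x).re / (2 * (Fintype.card S * (Fintype.card S + 1)))) ∧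
    HasSum (fun s => q s * (Complex.normSq (star y ⬝ᵥ v s) * (ketbraForm x y (v s)).re ^ 2))
      ((star x ⬝ᵥ x).re /
        (Fintype.card S * (Fintype.card S + 1) * (Fintype.card S + 2))) := by
  -- Both moments are quadratic in `x`, so a nonzero `x` may be normalized; `x = 0` is trivial.
  obtain ⟨r, hr, hrr⟩ : ∃ r : ℝ, 0 ≤ r ∧ star x ⬝ᵥ x = ((r ^ 2 : ℝ) : ℂ) := by
    refine ⟨‖WithLp.toLp 2 x‖, norm_nonneg _, ?_⟩
    rw [← dotProduct_comm, ← EuclideanSpace.inner_toLp_toLp, inner_self_eq_norm_sq_to_K]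
    simp
  rcases hr.eq_or_lt with rfl | hr
  · have hx : x = 0 := by simpa using hrr
    subst hx
    simp [ketbraForm, hasSum_zero]
  set z : S → ℂ := ((r⁻¹ : ℝ) : ℂ) • x with hz
  have hxz : x = (r : ℂ) • z := by
    rw [hz, smul_smul, ← Complex.ofReal_mul, mul_inv_cancel₀ hr.ne', Complex.ofReal_one, one_smul]
  have hzz : star z ⬝ᵥ z = 1 := by
    rw [hz, star_smul, smul_dotProduct, dotProduct_smul, hrr]
    simp only [RCLike.star_def, Complex.conj_ofReal, smul_eq_mul]
    norm_cast
    field_simp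
  have hzy : star z ⬝ᵥ y = 0 := by
    rw [hz, star_smul, smul_dotProduct, hxy, smul_zero]
  have hform : ∀ w, (ketbraForm x y w).re = r * (ketbraForm z y w).re := by
    intro w
    rw [hxz, ketbraForm, star_smul, smul_dotProduct]
    simp [ketbraForm]
    ring
  obtain ⟨i, j, hij, hF⟩ := sphereAvg_pair hzz hy hzy
  have m1 := sphereAvg_re_sq (S := S) hij (continuous_const (y := (1 : ℝ))) (fun _ => rfl)
  have m2 := sphereAvg_re_sq (S := S) hij (g := fun u => Complex.normSq (u j))
    (Complex.continuous_normSq.comp (continuous_apply j))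
    (fun u => by simp [Function.update_of_ne hij.symm])
  simp only [one_mul, sphereAvg_normSq_mul hij] at m1
  rw [sphereAvg_normSq_sq_mul hij] at m2
  have a1 := integratesExactly_quartic h hv z y
  have a2 := integratesExactly_sextic h z y
  rw [show (sphereAvg fun w => (ketbraForm z y w).re ^ 2) = _ from
    (hF (fun a b => (a * star b).re ^ 2)).trans m1] at a1
  rw [show (sphereAvg fun w => Complex.normSq (star y ⬝ᵥ w) * (ketbraForm z y w).re ^ 2) = _ from
    (hF (fun a b => Complex.normSq b * (a * star b).re ^ 2)).trans m2] at a2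
  simp only [hform]
  rw [hrr, Complex.ofReal_re]
  constructor
  · have := a1.mul_left (r ^ 2)
    simp only [div_eq_mul_inv, mul_inv] at this ⊢
    convert this using 1
    · rfl
    · funext s; ring
    · ring
  · have := a2.mul_left (r ^ 2)
    simp only [div_eq_mul_inv, mul_inv] at this ⊢
    convert this using 1
    · rfl
    · funext s; ring
    · ring

end DesignMoments

/-! ### Fisher-type sums over possibly infinitely many outcomes. -/

section FisherSums

variable {K Z : Type*} {pr : Z → ℝ} {a b : K → Z → ℝ}

/-- Matrix with entries `∑ a_j a_k / p` over the support of `p`. -/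
def scoreGram (pr : Z → ℝ) (a : K → Z → ℝ) : Matrix K K ℝ :=
  Matrix.of fun j k => ∑' z, if pr z = 0 then 0 else a j z * a k z / pr z

theorem score_term_le {p x y : ℝ} (hp : 0 ≤ p) (h : x ^ 2 ≤ 4 * p * y) (hy : 0 ≤ y) :
    (if p = 0 then 0 else x * x / p) ≤ 4 * y := by
  split_ifs with h0
  · positivity
  · have : 0 < p := lt_of_le_of_ne hp (Ne.symm h0)
    rw [div_le_iff₀ this]
    linarith

theorem score_term_nonneg {p : ℝ} (x : ℝ) (hp : 0 ≤ p) :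
    0 ≤ (if p = 0 then 0 else x * x / p) := by
  split_ifs
  · exact le_rfl
  · have := mul_self_nonneg x
    positivity

/-- Diagonal terms are dominated by 4b, and off-diagonal terms by the sum of two diagonal ones. Here
b stands for the Cauchy–Schwarz bound on the scores. -/
theorem summable_scoreGram (hp : ∀ z, 0 ≤ pr z) (hab : ∀ k z, a k z ^ 2 ≤ 4 * pr z * b k z)
    (hb : ∀ k z, 0 ≤ b k z) (hs : ∀ k, Summable (b k)) (j k : K) :
    Summable fun z => if pr z = 0 then 0 else a j z * a k z / pr z := by
  have hd : ∀ k, Summable fun z => if pr z = 0 then 0 else a k z * a k z / pr z := fun k =>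
    Summable.of_nonneg_of_le (fun z => score_term_nonneg _ (hp z))
      (fun z => score_term_le (hp z) (hab k z) (hb k z)) ((hs k).mul_left 4)
  refine Summable.of_norm_bounded ((hd j).add (hd k)) fun z => ?_
  split_ifs with h0
  · simp
  · have : 0 < pr z := lt_of_le_of_ne (hp z) (Ne.symm h0)
    rw [Real.norm_eq_abs, abs_div, abs_of_pos this, ← add_div]
    gcongr
    rw [abs_le]
    constructor <;> nlinarith [sq_nonneg (a j z + a k z), sq_nonneg (a j z - a k z),
      sq_nonneg (a j z), sq_nonneg (a k z)]

theorem scoreGram_diag_le (hp : ∀ z, 0 ≤ pr z) (hab : ∀ k z, a k z ^ 2 ≤ 4 * pr z * b k z)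
    (hb : ∀ k z, 0 ≤ b k z) {c : ℝ} {k : K} (hs : HasSum (b k) c) :
    scoreGram pr a k k ≤ 4 * c := by
  have h4 := hs.mul_left 4
  have hd : Summable fun z => if pr z = 0 then 0 else a k z * a k z / pr z :=
    Summable.of_nonneg_of_le (fun z => score_term_nonneg _ (hp z))
      (fun z => score_term_le (hp z) (hab k z) (hb k z)) h4.summable
  exact hasSum_le (fun z => score_term_le (hp z) (hab k z) (hb k z)) hd.hasSum h4

theorem scoreGram_isHermitian : (scoreGram pr a).IsHermitian := by
  ext j k
  simp only [scoreGram, Matrix.conjTranspose_apply, Matrix.of_apply, star_trivial, mul_comm]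

theorem hasSum_scoreGram [Fintype K] (hp : ∀ z, 0 ≤ pr z)
    (hab : ∀ k z, a k z ^ 2 ≤ 4 * pr z * b k z)
    (hb : ∀ k z, 0 ≤ b k z) (hs : ∀ k, Summable (b k)) (v : K → ℝ) :
    HasSum (fun z => if pr z = 0 then 0 else (∑ k, v k * a k z) ^ 2 / pr z)
      (v ⬝ᵥ (scoreGram pr a).mulVec v) := by
  have h : HasSum (fun z => ∑ j, v j * ∑ k, (if pr z = 0 then 0 else a j z * a k z / pr z) * v k)
      (∑ j, v j * ∑ k, scoreGram pr a j k * v k) :=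
    hasSum_sum fun j _ => HasSum.mul_left (v j) (hasSum_sum fun k _ =>
      HasSum.mul_right (v k) (summable_scoreGram hp hab hb hs j k).hasSum)
  change HasSum _ (∑ j, v j * ∑ k, scoreGram pr a j k * v k)
  convert h using 1
  funext z
  split_ifs with h0
  · simp
  · rw [pow_two, Finset.sum_mul_sum, Finset.sum_div]
    refine Finset.sum_congr rfl fun j _ => ?_
    rw [Finset.sum_div, Finset.mul_sum]
    exact Finset.sum_congr rfl fun k _ => by ring

/-- Cauchy–Schwarz lower bound for the quadratic form of the Fisher matrix. -/
theorem le_scoreGram [Fintype K] (hp : ∀ z, 0 ≤ pr z) (hab : ∀ k z, a k z ^ 2 ≤ 4 * pr z * b k z)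
    (hb : ∀ k z, 0 ≤ b k z) (hs : ∀ k, Summable (b k)) (v : K → ℝ) (f : Z → ℝ) {s₁ s₂ : ℝ}
    (h₁ : HasSum (fun z => (∑ k, v k * a k z) * f z) s₁)
    (h₂ : HasSum (fun z => pr z * f z ^ 2) s₂) :
    2 * s₁ - s₂ ≤ v ⬝ᵥ (scoreGram pr a).mulVec v := by
  refine hasSum_le (fun z => ?_) ((h₁.mul_left 2).sub h₂) (hasSum_scoreGram hp hab hb hs v)
  split_ifs with h0
  -- At an outcome of probability zero the Cauchy–Schwarz hypothesis forces every score to vanish,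
  -- so omitting it from the Fisher sum loses nothing.
  · have : ∀ k, a k z = 0 := fun k => by
      have := hab k z
      rw [h0] at this
      nlinarith [sq_nonneg (a k z)]
    simp [this, h0]
  · have : 0 < pr z := lt_of_le_of_ne (hp z) (Ne.symm h0)
    rw [le_div_iff₀ this]
    -- Completing the square: s²/p ≥ 2sf - pf².
    nlinarith [sq_nonneg ((∑ k, v k * a k z) - pr z * f z)]

end FisherSums

/-! ### Trace of the inverse of a positive definite matrix. -/

section MatrixBounds

variable {K : Type*} [Fintype K]

/-- Matrix form of the tangent line to 1/x at 4: from (1 - A/4)A⁻¹(1 - A/4) ≥ 0 one gets A⁻¹ ≥ 1/2 -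
A/16, whose trace involves only the diagonal of A. -/
theorem trace_inv_ge [DecidableEq K] {A : Matrix K K ℝ} (hA : A.PosDef) (hd : ∀ k, A k k ≤ 4) :
    (Fintype.card K : ℝ) / 4 ≤ A⁻¹.trace := by
  have hdet : IsUnit A.det := (Matrix.isUnit_iff_isUnit_det _).mp hA.isUnit
  have h := (hA.inv.posSemidef.conjTranspose_mul_mul_same (1 - (1 / 4 : ℝ) • A)).trace_nonneg
  have e : (1 - (1 / 4 : ℝ) • A).conjTranspose * A⁻¹ * (1 - (1 / 4 : ℝ) • A) =
      A⁻¹ - (1 / 2 : ℝ) • 1 + (1 / 16 : ℝ) • A := by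
    rw [Matrix.conjTranspose_sub, Matrix.conjTranspose_smul, hA.isHermitian.eq,
      Matrix.conjTranspose_one, star_trivial]
    simp only [sub_mul, mul_sub, one_mul, mul_one, smul_mul_assoc, mul_smul_comm,
      Matrix.mul_nonsing_inv _ hdet, Matrix.nonsing_inv_mul _ hdet]
    module
  rw [e, Matrix.trace_add, Matrix.trace_sub, Matrix.trace_smul, Matrix.trace_smul,
    Matrix.trace_one] at h
  have ht : A.trace ≤ ∑ _k : K, (4 : ℝ) := Finset.sum_le_sum fun k _ => hd k
  simp only [Finset.sum_const, Finset.card_univ, nsmul_eq_mul, smul_eq_mul] at ht h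
  linarith

theorem posDef_of_le {A : Matrix K K ℝ} (hA : A.IsHermitian) {c : ℝ} (hc : 0 < c)
    (h : ∀ v : K → ℝ, c * (v ⬝ᵥ v) ≤ v ⬝ᵥ A.mulVec v) : A.PosDef := by
  refine Matrix.PosDef.of_dotProduct_mulVec_pos hA fun x hx => ?_
  rw [star_trivial]
  refine lt_of_lt_of_le (mul_pos hc ?_) (h x)
  have := Matrix.dotProduct_star_self_pos_iff.mpr hx
  rwa [star_trivial] at this

/-- For x = A⁻¹eₖ the hypothesis reads c|x|² ≤ xₖ, and xₖ² ≤ |x|² then gives xₖ ≤ 1/c, where xₖ is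
the k-th diagonal entry of A⁻¹. -/
theorem trace_inv_le [DecidableEq K] {A : Matrix K K ℝ} (hA : A.IsHermitian) {c : ℝ} (hc : 0 < c)
    (h : ∀ v : K → ℝ, c * (v ⬝ᵥ v) ≤ v ⬝ᵥ A.mulVec v) :
    A⁻¹.trace ≤ Fintype.card K / c := by
  have hP := posDef_of_le hA hc h
  have hdet : IsUnit A.det := (Matrix.isUnit_iff_isUnit_det _).mp hP.isUnit
  have hk : ∀ k, A⁻¹ k k ≤ 1 / c := by
    intro k
    set x : K → ℝ := A⁻¹.mulVec (Pi.single k 1) with hx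
    have hxk : x k = A⁻¹ k k := by simp [hx]
    have h1 := h x
    rw [hx, Matrix.mulVec_mulVec, Matrix.mul_nonsing_inv _ hdet, Matrix.one_mulVec, ← hx,
      dotProduct_single, mul_one] at h1
    have h2 : x k * x k ≤ x ⬝ᵥ x :=
      Finset.single_le_sum (f := fun i => x i * x i) (fun i _ => mul_self_nonneg _)
        (Finset.mem_univ k)
    have h3 : 0 < A⁻¹ k k := hP.inv.diag_pos
    rw [← hxk] at h3 ⊢
    rw [le_div_iff₀ hc]
    nlinarith
  calc A⁻¹.trace ≤ ∑ _k : K, 1 / c := Finset.sum_le_sum fun k _ => hk k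
    _ = Fintype.card K / c := by
      rw [Finset.sum_const, Finset.card_univ, nsmul_eq_mul, mul_one_div]

end MatrixBounds

/-! ### Derivatives of outcome probabilities and the Cauchy–Schwarz bound. -/

section Score

variable {S : Type} [Fintype S]

theorem star_dotProduct_mulVec_comm {M : Matrix S S ℂ} (hM : M.IsHermitian) (x y : S → ℂ) :
    star x ⬝ᵥ M.mulVec y = star (star y ⬝ᵥ M.mulVec x) := by
  rw [← Matrix.star_dotProduct_star, star_star, Matrix.star_mulVec, hM.eq,
    Matrix.dotProduct_mulVec]

/-- The form of M at tx + y is a nonnegative quadratic in the real variable t, so its discriminant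
is nonpositive. -/
theorem re_dotProduct_mulVec_sq_le {M : Matrix S S ℂ} (hM : M.PosSemidef) (x y : S → ℂ) :
    (star x ⬝ᵥ M.mulVec y).re ^ 2 ≤
      (star y ⬝ᵥ M.mulVec y).re * (star x ⬝ᵥ M.mulVec x).re := by
  have h : ∀ t : ℝ, 0 ≤ (star x ⬝ᵥ M.mulVec x).re * (t * t) +
      2 * (star x ⬝ᵥ M.mulVec y).re * t + (star y ⬝ᵥ M.mulVec y).re := by
    intro t
    have h := (Complex.le_def.mp (hM.dotProduct_mulVec_nonneg ((t : ℂ) • x + y))).1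
    have hc := star_dotProduct_mulVec_comm hM.isHermitian y x
    simp only [star_add, star_smul, Matrix.mulVec_add, Matrix.mulVec_smul, add_dotProduct,
      dotProduct_add, smul_dotProduct, dotProduct_smul, hc, smul_eq_mul, RCLike.star_def,
      Complex.conj_ofReal, Complex.add_re, Complex.re_ofReal_mul, Complex.conj_re,
      Complex.zero_re] at h
    linarith
  have := discrim_le_zero h
  rw [discrim] at this
  nlinarith

theorem trace_ketbra_mul (w : S → ℂ) (A M : Matrix S S ℂ) :
    (A * ketbra w * A.conjTranspose * M).trace =
      star (A.mulVec w) ⬝ᵥ M.mulVec (A.mulVec w) := by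
  rw [ketbra, Matrix.mul_vecMulVec, Matrix.vecMulVec_mul, ← Matrix.star_mulVec,
    Matrix.vecMulVec_mul, Matrix.trace_vecMulVec, Matrix.dotProduct_mulVec, dotProduct_comm]

theorem hasDerivAt_quadForm {w : ℝ → S → ℂ} {w' : S → ℂ} {t : ℝ} (hw : HasDerivAt w w' t)
    {M : Matrix S S ℂ} (hM : M.IsHermitian) :
    HasDerivAt (fun t => (star (w t) ⬝ᵥ M.mulVec (w t)).re)
      (2 * (star w' ⬝ᵥ M.mulVec (w t)).re) t := by
  have hi := hasDerivAt_pi.mp hw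
  have h : HasDerivAt (fun t => ∑ i, star (w t i) * ∑ j, M i j * w t j)
      (∑ i, (star (w' i) * (∑ j, M i j * w t j) + star (w t i) * ∑ j, M i j * w' j)) t :=
    HasDerivAt.fun_sum fun i _ => (hi i).star.mul (HasDerivAt.fun_sum fun j _ =>
      (hi j).const_mul (M i j))
  have h2 := Complex.reCLM.hasFDerivAt.comp_hasDerivAt t h
  have e : (∑ i, (star (w' i) * (∑ j, M i j * w t j) + star (w t i) * ∑ j, M i j * w' j)) =
      star w' ⬝ᵥ M.mulVec (w t) + star (w t) ⬝ᵥ M.mulVec w' := by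
    rw [Finset.sum_add_distrib]; rfl
  rw [e, star_dotProduct_mulVec_comm hM (w t) w'] at h2
  exact h2.congr_deriv (by simp [two_mul])

/-- The tangent vector `-i (P ⊗ 1) ψ`. -/
def tangent {n : ℕ} {A : Type} [Fintype A] [DecidableEq A] (H : Matrix (Qubits n) (Qubits n) ℂ)
    (ψ : Qubits n × A → ℂ) : Qubits n × A → ℂ :=
  -Complex.I • (H ⊗ₖ (1 : Matrix A A ℂ)).mulVec ψ

theorem evol_smul_single {n : ℕ} (j : Par n) (t : ℝ) :
    evol (t • Pi.single j 1) = NormedSpace.exp (t • (-Complex.I • pauli j.1)) := by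
  unfold evol
  congr 1
  rw [Finset.sum_eq_single j]
  · rw [Pi.smul_apply, Pi.single_eq_same, smul_eq_mul, mul_one, smul_comm, Complex.coe_smul]
  · intro k _ hk
    simp [hk]
  · simp

section

attribute [local instance] Matrix.linftyOpNormedRing Matrix.linftyOpNormedAlgebra

/-- Along a coordinate axis only one generator is present, so noncommutativity of the Paulis plays
no role. The matrix norm is an auxiliary choice for differentiating the exponential. -/
theorem hasDerivAt_evol {n : ℕ} {A : Type} [Fintype A] [DecidableEq A] (j : Par n)
    (ψ : Qubits n × A → ℂ) :
    HasDerivAt (fun t : ℝ =>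
      (evol (t • Pi.single j 1) ⊗ₖ (1 : Matrix A A ℂ)).mulVec ψ) (tangent (pauli j.1) ψ) 0 := by
  let L : Matrix (Qubits n) (Qubits n) ℂ →ₗ[ℝ] (Qubits n × A → ℂ) :=
    { toFun := fun B => (B ⊗ₖ (1 : Matrix A A ℂ)).mulVec ψ
      map_add' := fun B C => by rw [Matrix.add_kronecker, Matrix.add_mulVec]
      map_smul' := fun r B => by
        rw [Matrix.smul_kronecker, Matrix.smul_mulVec, RingHom.id_apply] }
  have h := hasDerivAt_exp_smul_const (𝕂 := ℝ) (-Complex.I • pauli j.1 :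
    Matrix (Qubits n) (Qubits n) ℂ) 0
  rw [zero_smul, NormedSpace.exp_zero, one_mul] at h
  have h2 := (LinearMap.toContinuousLinearMap L).hasFDerivAt.comp_hasDerivAt (0 : ℝ) h
  have e : tangent (pauli j.1) ψ = L (-Complex.I • pauli j.1) := by
    simp only [tangent, L, LinearMap.coe_mk, AddHom.coe_mk, Matrix.smul_kronecker,
      Matrix.smul_mulVec]
  rw [e]
  simp only [evol_smul_single]
  exact h2

end

theorem evol_zero {n : ℕ} : evol (0 : Par n → ℝ) = 1 := by
  simp [evol]

theorem prob_zero {n : ℕ} (E : Protocol n) (z : Σ i, E.X i) :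
    E.prob 0 z = E.p z.1 * (star (E.ψ z.1) ⬝ᵥ ((E.M z.1).elem z.2).mulVec (E.ψ z.1)).re := by
  rw [Protocol.prob, outState, trace_ketbra_mul, evol_zero, Matrix.one_kronecker_one,
    Matrix.one_mulVec]

/-- The derivative of the outcome probability in the direction generated by `H`. -/
def Protocol.score {n : ℕ} (E : Protocol n) (H : Matrix (Qubits n) (Qubits n) ℂ)
    (z : Σ i, E.X i) : ℝ :=
  E.p z.1 * (2 * (star (tangent H (E.ψ z.1)) ⬝ᵥ ((E.M z.1).elem z.2).mulVec (E.ψ z.1)).re)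

theorem lineDeriv_prob {n : ℕ} (E : Protocol n) (j : Par n) (z : Σ i, E.X i) :
    lineDeriv ℝ (fun t => E.prob t z) 0 (Pi.single j 1) = E.score (pauli j.1) z := by
  rw [lineDeriv]
  have h := (hasDerivAt_quadForm (hasDerivAt_evol j (E.ψ z.1))
    ((E.M z.1).posSemidef z.2).isHermitian).const_mul (E.p z.1)
  rw [zero_smul, evol_zero, Matrix.one_kronecker_one, Matrix.one_mulVec] at h
  refine (HasDerivAt.deriv ?_).trans rfl
  refine h.congr_of_eventuallyEq (Filter.Eventually.of_forall fun t => ?_)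
  simp only [Protocol.prob, outState, trace_ketbra_mul, zero_add]

theorem cfim_eq_scoreGram {n : ℕ} (E : Protocol n) :
    E.cfim = scoreGram (E.prob 0) fun j => E.score (pauli j.1) := by
  ext j k
  simp only [Protocol.cfim, fisherInfo, scoreGram, Matrix.of_apply, lineDeriv_prob]

/-- The Cauchy–Schwarz bound for the score. -/
def Protocol.scoreBound {n : ℕ} (E : Protocol n) (H : Matrix (Qubits n) (Qubits n) ℂ)
    (z : Σ i, E.X i) : ℝ :=
  E.p z.1 * (star (tangent H (E.ψ z.1)) ⬝ᵥ
    ((E.M z.1).elem z.2).mulVec (tangent H (E.ψ z.1))).re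

theorem prob_nonneg {n : ℕ} (E : Protocol n) (z : Σ i, E.X i) : 0 ≤ E.prob 0 z := by
  rw [prob_zero]
  exact mul_nonneg (E.p_nonneg _)
    (Complex.le_def.mp (((E.M z.1).posSemidef z.2).dotProduct_mulVec_nonneg _)).1

theorem scoreBound_nonneg {n : ℕ} (E : Protocol n) (H : Matrix (Qubits n) (Qubits n) ℂ)
    (z : Σ i, E.X i) : 0 ≤ E.scoreBound H z :=
  mul_nonneg (E.p_nonneg _)
    (Complex.le_def.mp (((E.M z.1).posSemidef z.2).dotProduct_mulVec_nonneg _)).1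

theorem score_sq_le {n : ℕ} (E : Protocol n) (H : Matrix (Qubits n) (Qubits n) ℂ)
    (z : Σ i, E.X i) : E.score H z ^ 2 ≤ 4 * E.prob 0 z * E.scoreBound H z := by
  have h := re_dotProduct_mulVec_sq_le ((E.M z.1).posSemidef z.2) (tangent H (E.ψ z.1)) (E.ψ z.1)
  have h' := mul_le_mul_of_nonneg_left h (sq_nonneg (2 * E.p z.1))
  rw [prob_zero, Protocol.score, Protocol.scoreBound]
  linarith

theorem hasSum_sigma_of_nonneg {ι : Type*} {Y : ι → Type*} {f : (Σ i, Y i) → ℝ} {g : ι → ℝ}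
    {c : ℝ} (hf : ∀ z, 0 ≤ f z) (hg : ∀ i, HasSum (fun y => f ⟨i, y⟩) (g i)) (hc : HasSum g c) :
    HasSum f c := by
  have hs : Summable f := (summable_sigma_of_nonneg hf).mpr
    ⟨fun i => (hg i).summable, by simpa only [(hg _).tsum_eq] using hc.summable⟩
  have h := hs.hasSum.sigma hg
  rw [← h.unique hc]
  exact hs.hasSum

theorem hasSum_povm {S X : Type} [Fintype S] [DecidableEq S] (M : POVM S X) (w : S → ℂ) :
    HasSum (fun x => (star w ⬝ᵥ (M.elem x).mulVec w).re) (star w ⬝ᵥ w).re := by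
  let L : Matrix S S ℂ →+ ℝ :=
    { toFun := fun B => (star w ⬝ᵥ B.mulVec w).re
      map_zero' := by simp
      map_add' := fun B C => by simp [Matrix.add_mulVec, dotProduct_add] }
  have hL : Continuous L := by
    change Continuous fun B : Matrix S S ℂ => (star w ⬝ᵥ B.mulVec w).re
    fun_prop
  have h := M.hasSum_elem.map L hL
  simpa [L, Function.comp_def] using h

/-- For each input the POVM elements sum to the identity, leaving the squared norm of the tangent
vector, which is 1 because H is unitary and the input is a unit vector. -/
theorem hasSum_scoreBound {n : ℕ} (E : Protocol n) {H : Matrix (Qubits n) (Qubits n) ℂ}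
    (hH : H.conjTranspose * H = 1) : HasSum (E.scoreBound H) 1 := by
  refine hasSum_sigma_of_nonneg (scoreBound_nonneg E H) (g := E.p) (fun i => ?_) E.hasSum_p
  have h := (hasSum_povm (E.M i) (tangent H (E.ψ i))).mul_left (E.p i)
  have e : star (tangent H (E.ψ i)) ⬝ᵥ tangent H (E.ψ i) = 1 := by
    rw [tangent, star_smul, smul_dotProduct, dotProduct_smul, Matrix.star_mulVec,
      Matrix.dotProduct_mulVec, Matrix.vecMul_vecMul, Matrix.conjTranspose_kronecker,
      ← Matrix.mul_kronecker_mul, hH]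
    simp [E.ψ_unit]
  rw [e, Complex.one_re, mul_one] at h
  exact h

end Score

/-! ### Lower bound on the Fisher matrix of a design measurement by the mean variance. -/

section DesignBound

/-- The second and third moments, in orthogonal directions, of the vectors of a `3`-design. -/
def POVM.HasDesignMoments {S X : Type} [Fintype S] [DecidableEq S] (M : POVM S X) : Prop :=
  ∃ (q : X → ℝ) (v : X → S → ℂ), (∀ s, 0 < q s) ∧
    (∀ s, M.elem s = ((q s * Fintype.card S : ℝ) : ℂ) • ketbra (v s)) ∧
    ∀ x y : S → ℂ, star y ⬝ᵥ y = 1 → star x ⬝ᵥ y = 0 →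
      HasSum (fun s => q s * (ketbraForm x y (v s)).re ^ 2)
        ((star x ⬝ᵥ x).re / (2 * (Fintype.card S * (Fintype.card S + 1)))) ∧
      HasSum (fun s => q s * (Complex.normSq (star y ⬝ᵥ v s) * (ketbraForm x y (v s)).re ^ 2))
        ((star x ⬝ᵥ x).re /
          (Fintype.card S * (Fintype.card S + 1) * (Fintype.card S + 2)))

theorem POVM.IsThreeDesign.hasDesignMoments {S X : Type} [Fintype S] [DecidableEq S]
    {M : POVM S X} (hM : M.IsThreeDesign) : M.HasDesignMoments := by
  obtain ⟨q, v, hq, hv, hM, h⟩ := hM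
  exact ⟨q, v, hq, hM, fun x y hy hxy => threeDesign_moments h hv hy hxy⟩

theorem POVM.HasDesignMoments.withTrivialAncilla {S X : Type} [Fintype S] [DecidableEq S]
    {M : POVM S X} (hM : M.HasDesignMoments) : M.withTrivialAncilla.HasDesignMoments := by
  obtain ⟨q, v, hq, hM, h⟩ := hM
  have hd : ∀ (x y : S × Unit → ℂ), star x ⬝ᵥ y =
      star (fun a => x (a, ())) ⬝ᵥ fun a => y (a, ()) := fun x y => by
    simp [dotProduct, Fintype.sum_prod_type]
  refine ⟨q, fun s z => v s z.1, hq, fun s => ?_, fun x y hy hxy => ?_⟩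
  · ext a b
    have := congrFun (congrFun (hM s) a.1) b.1
    simpa [POVM.withTrivialAncilla, ketbra, Matrix.vecMulVec_apply] using this
  · rw [hd] at hy hxy
    have := h _ _ hy hxy
    simpa only [ketbraForm, hd, Fintype.card_prod, Fintype.card_unit, mul_one] using this

theorem ketbra_mulVec {S : Type} [Fintype S] (x y w : S → ℂ) :
    star x ⬝ᵥ (ketbra w).mulVec y = ketbraForm x y w := by
  rw [ketbra, Matrix.vecMulVec_mulVec, dotProduct_smul, ketbraForm, ← Matrix.star_dotProduct_star,
    star_star]
  simp

theorem design_prob {S : Type} [Fintype S] {ψ w : S → ℂ} (c : ℝ) :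
    (star ψ ⬝ᵥ ((c : ℂ) • ketbra w).mulVec ψ).re = c * Complex.normSq (star ψ ⬝ᵥ w) := by
  rw [Matrix.smul_mulVec, dotProduct_smul, ketbra_mulVec, smul_eq_mul, Complex.re_ofReal_mul,
    ketbraForm, RCLike.star_def, Complex.mul_conj, Complex.ofReal_re]

theorem isHermitian_kronecker_one {n : ℕ} {A : Type} [DecidableEq A]
    {H : Matrix (Qubits n) (Qubits n) ℂ} (hH : H.IsHermitian) :
    (H ⊗ₖ (1 : Matrix A A ℂ)).IsHermitian := by
  rw [Matrix.IsHermitian, Matrix.conjTranspose_kronecker, hH.eq, Matrix.conjTranspose_one]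

variable {n : ℕ} {A : Type} [Fintype A] [DecidableEq A]

/-- Expectation value of `H ⊗ 1`. -/
def expVal (H : Matrix (Qubits n) (Qubits n) ℂ) (ψ : Qubits n × A → ℂ) : ℂ :=
  star ψ ⬝ᵥ (H ⊗ₖ (1 : Matrix A A ℂ)).mulVec ψ

/-- Variance of the Hermitian observable `H ⊗ 1`. -/
def variance (H : Matrix (Qubits n) (Qubits n) ℂ) (ψ : Qubits n × A → ℂ) : ℝ :=
  (star (tangent H ψ) ⬝ᵥ tangent H ψ).re - (expVal H ψ).re ^ 2

/-- Component of the tangent vector orthogonal to the state. -/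
def normalTangent (H : Matrix (Qubits n) (Qubits n) ℂ) (ψ : Qubits n × A → ℂ) :
    Qubits n × A → ℂ :=
  tangent H ψ + (Complex.I * (expVal H ψ).re) • ψ

theorem star_tangent_dotProduct {H : Matrix (Qubits n) (Qubits n) ℂ} (hH : H.IsHermitian)
    (ψ : Qubits n × A → ℂ) :
    star (tangent H ψ) ⬝ᵥ ψ = Complex.I * (expVal H ψ).re := by
  have h := star_dotProduct_mulVec_comm (isHermitian_kronecker_one (A := A) hH) ψ ψ
  have hre : ((expVal H ψ).re : ℂ) = expVal H ψ := Complex.conj_eq_iff_re.mp h.symm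
  rw [hre, tangent, star_smul, smul_dotProduct, Matrix.star_mulVec,
    (isHermitian_kronecker_one hH).eq, ← Matrix.dotProduct_mulVec]
  simp [expVal]

theorem star_normalTangent_dotProduct {H : Matrix (Qubits n) (Qubits n) ℂ} (hH : H.IsHermitian)
    {ψ : Qubits n × A → ℂ} (hψ : star ψ ⬝ᵥ ψ = 1) : star (normalTangent H ψ) ⬝ᵥ ψ = 0 := by
  rw [normalTangent, star_add, add_dotProduct, star_smul, smul_dotProduct, hψ,
    star_tangent_dotProduct hH]
  simp

theorem normSq_normalTangent {H : Matrix (Qubits n) (Qubits n) ℂ} (hH : H.IsHermitian)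
    {ψ : Qubits n × A → ℂ} (hψ : star ψ ⬝ᵥ ψ = 1) :
    (star (normalTangent H ψ) ⬝ᵥ normalTangent H ψ).re = variance H ψ := by
  conv_lhs => rw [normalTangent.eq_1 H ψ]
  rw [dotProduct_add, dotProduct_smul, ← normalTangent, star_normalTangent_dotProduct hH hψ,
    normalTangent, star_add, add_dotProduct, star_smul, smul_dotProduct,
    ← star_star (star ψ ⬝ᵥ tangent H ψ), ← Matrix.star_dotProduct_star, star_star,
    star_tangent_dotProduct hH, variance]
  simp
  ring

/-- The component of the tangent along ψ is an imaginary multiple of ψ and contributes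
i·real·|⟨ψ|w⟩|², which has no real part. Only the orthogonal component matters, which is what the
design moments require. -/
theorem design_score {H : Matrix (Qubits n) (Qubits n) ℂ} {ψ w : Qubits n × A → ℂ} (c : ℝ) :
    (star (tangent H ψ) ⬝ᵥ ((c : ℂ) • ketbra w).mulVec ψ).re =
      c * (ketbraForm (normalTangent H ψ) ψ w).re := by
  rw [Matrix.smul_mulVec, dotProduct_smul, ketbra_mulVec, smul_eq_mul, Complex.re_ofReal_mul]
  congr 1
  rw [ketbraForm, ketbraForm, normalTangent, star_add, add_dotProduct, add_mul, star_smul,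
    smul_dotProduct]
  simp [Complex.mul_re]
  ring

theorem variance_nonneg {H : Matrix (Qubits n) (Qubits n) ℂ} (hH : H.IsHermitian)
    {ψ : Qubits n × A → ℂ} (hψ : star ψ ⬝ᵥ ψ = 1) : 0 ≤ variance H ψ := by
  rw [← normSq_normalTangent hH hψ]
  exact (Complex.le_def.mp (dotProduct_star_self_nonneg (normalTangent H ψ))).1

/-- The generator `∑ v_k P_k`. -/
def generator (v : Par n → ℝ) : Matrix (Qubits n) (Qubits n) ℂ :=
  ∑ k : Par n, (v k : ℂ) • pauli k.1

theorem tangent_generator (v : Par n → ℝ) (ψ : Qubits n × A → ℂ) :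
    tangent (generator v) ψ = ∑ k : Par n, (v k : ℂ) • tangent (pauli k.1) ψ := by
  let L : Matrix (Qubits n) (Qubits n) ℂ →ₗ[ℂ] (Qubits n × A → ℂ) :=
    { toFun := fun B => tangent B ψ
      map_add' := fun B C => by
        simp only [tangent, Matrix.add_kronecker, Matrix.add_mulVec, smul_add]
      map_smul' := fun r B => by
        simp only [tangent, Matrix.smul_kronecker, Matrix.smul_mulVec, RingHom.id_apply]
        rw [smul_comm] }
  change L (∑ k : Par n, (v k : ℂ) • pauli k.1) = ∑ k : Par n, (v k : ℂ) • L (pauli k.1)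
  simp

theorem score_generator (E : Protocol n) (v : Par n → ℝ) (z : Σ i, E.X i) :
    E.score (generator v) z = ∑ k, v k * E.score (pauli k.1) z := by
  simp only [Protocol.score, tangent_generator, star_sum, star_smul, sum_dotProduct,
    smul_dotProduct, Complex.re_sum, Finset.mul_sum, RCLike.star_def, Complex.conj_ofReal,
    smul_eq_mul, Complex.re_ofReal_mul]
  exact Finset.sum_congr rfl fun k _ => by ring

theorem hasSum_of_eq {X : Type*} {f g : X → ℝ} {c : ℝ} (h : ∀ x, f x = g x) (hg : HasSum g c) :
    HasSum f c := by
  rwa [funext h]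

theorem le_cfim_of_design (E : Protocol n) [Fintype E.ι] (hM : ∀ i, (E.M i).HasDesignMoments)
    (hP : ∀ k : Par n, (pauli k.1).conjTranspose * pauli k.1 = 1)
    (v : Par n → ℝ) (hH : (generator v).IsHermitian) :
    ∑ i, E.p i * variance (generator v) (E.ψ i) ≤ v ⬝ᵥ E.cfim.mulVec v := by
  choose q w hq hel hmom using hM
  set H := generator v with hHdef
  obtain ⟨D, hD⟩ : ∃ D : E.ι → ℝ, ∀ i, D i = (Fintype.card (Qubits n × E.A i) : ℝ) :=
    ⟨_, fun _ => rfl⟩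
  simp only [← hD] at hel hmom
  -- A unit vector exists, so the space is not zero-dimensional.
  have hDpos : ∀ i, 0 < D i := by
    intro i
    have : Nonempty (Qubits n × E.A i) := by
      by_contra hne
      rw [not_nonempty_iff] at hne
      simpa [dotProduct] using E.ψ_unit i
    rw [hD]
    exact Nat.cast_pos.mpr Fintype.card_pos
  set V : E.ι → ℝ := fun i => variance H (E.ψ i) with hV
  have hm := fun i => hmom i _ _ (E.ψ_unit i) (star_normalTangent_dotProduct hH (E.ψ_unit i))
  simp only [normSq_normalTangent hH (E.ψ_unit _)] at hm
  -- The factor D + 2 is the ratio of second to third moments that makes ∑ s f and ∑ p f² equal,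
  -- which maximizes 2∑ s f - ∑ p f² over rescalings of f on each input.
  let f : (Σ i, E.X i) → ℝ := fun z =>
    (D z.1 + 2) * (ketbraForm (normalTangent H (E.ψ z.1)) (E.ψ z.1) (w z.1 z.2)).re
  have hs : ∀ z, E.score H z = E.p z.1 * (2 * (q z.1 z.2 * D z.1 *
      (ketbraForm (normalTangent H (E.ψ z.1)) (E.ψ z.1) (w z.1 z.2)).re)) := by
    intro z
    rw [Protocol.score, hel, design_score]
  have hp : ∀ z, E.prob 0 z = E.p z.1 * (q z.1 z.2 * D z.1 *
      Complex.normSq (star (E.ψ z.1) ⬝ᵥ w z.1 z.2)) := by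
    intro z
    rw [prob_zero, hel, design_prob]
  have hp0 := E.p_nonneg
  have h₁ : HasSum (fun z => E.score H z * f z)
      (∑ i, E.p i * (V i * ((D i + 2) / (D i + 1)))) := by
    refine hasSum_sigma_of_nonneg (fun z => ?_) (fun i => ?_) (hasSum_fintype _)
    · have := hDpos z.1
      have := hq z.1 z.2
      have := hp0 z.1
      rw [hs]
      refine (show 0 ≤ E.p z.1 * (2 * (q z.1 z.2 * D z.1)) * (D z.1 + 2) * (ketbraForm
        (normalTangent H (E.ψ z.1)) (E.ψ z.1) (w z.1 z.2)).re ^ 2 by positivity).trans_eq ?_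
      simp only [f]
      ring
    · have := hDpos i
      have h := (hm i).1.mul_left (E.p i * (2 * D i * (D i + 2)))
      have e : E.p i * (V i * ((D i + 2) / (D i + 1))) = E.p i * (2 * D i * (D i + 2)) *
          (V i / (2 * (D i * (D i + 1)))) := by
        field_simp
      rw [e]
      refine hasSum_of_eq (fun s => ?_) h
      simp only [hs, f]
      ring
  have h₂ : HasSum (fun z => E.prob 0 z * f z ^ 2)
      (∑ i, E.p i * (V i * ((D i + 2) / (D i + 1)))) := by
    refine hasSum_sigma_of_nonneg (fun z => mul_nonneg (prob_nonneg E z) (sq_nonneg _))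
      (fun i => ?_) (hasSum_fintype _)
    have := hDpos i
    have h := (hm i).2.mul_left (E.p i * (D i * (D i + 2) ^ 2))
    have e : E.p i * (V i * ((D i + 2) / (D i + 1))) = E.p i * (D i * (D i + 2) ^ 2) *
        (V i / (D i * (D i + 1) * (D i + 2))) := by
      field_simp
    rw [e]
    refine hasSum_of_eq (fun s => ?_) h
    simp only [hp, f]
    ring
  rw [cfim_eq_scoreGram]
  have h₁' : HasSum (fun z => (∑ k, v k * E.score (pauli k.1) z) * f z)
      (∑ i, E.p i * (V i * ((D i + 2) / (D i + 1)))) :=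
    hasSum_of_eq (fun z => by rw [hHdef, score_generator]) h₁
  have hsum : ∀ k : Par n, Summable (E.scoreBound (pauli k.1)) := fun k =>
    (hasSum_scoreBound E (hP k)).summable
  clear_value f
  have h := le_scoreGram (pr := E.prob 0) (a := fun k : Par n => E.score (pauli k.1))
    (b := fun k : Par n => E.scoreBound (pauli k.1)) (prob_nonneg E)
    (fun k z => score_sq_le E (pauli k.1) z) (fun k z => scoreBound_nonneg E (pauli k.1) z) hsum
    v f h₁' h₂
  refine le_trans ?_ h
  rw [two_mul, add_sub_cancel_right]
  refine Finset.sum_le_sum fun i _ => mul_le_mul_of_nonneg_left ?_ (hp0 i)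
  -- The bound obtained carries the factor (D + 2)/(D + 1), which is at least 1 and is dropped.
  refine le_mul_of_one_le_right (variance_nonneg hH (E.ψ_unit i)) ?_
  have := hDpos i
  rw [le_div_iff₀ (by positivity)]
  linarith

end DesignBound

/-! ### Algebra of Pauli strings, reduced to single-qubit checks. -/

section Pauli

variable {n : ℕ}

/-- Tensor product of single-qubit matrices. -/
def tensorQubits (A : Fin n → Matrix (Fin 2) (Fin 2) ℂ) : Matrix (Qubits n) (Qubits n) ℂ :=
  Matrix.of fun x y => ∏ i, A i (x i) (y i)

theorem pauli_eq_tensorQubits (P : PauliString n) : pauli P = tensorQubits fun i => sigma (P i) :=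
  rfl

theorem tensorQubits_mul (A B : Fin n → Matrix (Fin 2) (Fin 2) ℂ) :
    tensorQubits A * tensorQubits B = tensorQubits fun i => A i * B i := by
  ext x y
  simp only [tensorQubits, Matrix.mul_apply, Matrix.of_apply, ← Finset.prod_mul_distrib]
  rw [Finset.prod_univ_sum, Fintype.piFinset_univ]

theorem trace_tensorQubits (A : Fin n → Matrix (Fin 2) (Fin 2) ℂ) :
    (tensorQubits A).trace = ∏ i, (A i).trace := by
  simp only [tensorQubits, Matrix.trace, Matrix.diag_apply, Matrix.of_apply]
  rw [Finset.prod_univ_sum, Fintype.piFinset_univ]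

theorem tensorQubits_smul (c : Fin n → ℂ) (A : Fin n → Matrix (Fin 2) (Fin 2) ℂ) :
    tensorQubits (fun i => c i • A i) = (∏ i, c i) • tensorQubits A := by
  ext x y
  simp [tensorQubits, Finset.prod_mul_distrib]

theorem conjTranspose_tensorQubits (A : Fin n → Matrix (Fin 2) (Fin 2) ℂ) :
    (tensorQubits A).conjTranspose = tensorQubits fun i => (A i).conjTranspose := by
  ext x y
  simp [tensorQubits]

theorem tensorQubits_one : tensorQubits (fun _ : Fin n => 1) = 1 := by
  ext x y
  simp only [tensorQubits, Matrix.of_apply, Matrix.one_apply]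
  rw [Finset.prod_ite_zero]
  simp [funext_iff]

/-- Phase of the product of two matrices `sigma`. -/
def sigmaPhase : Fin 4 → Fin 4 → ℂ :=
  ![![1, 1, 1, 1], ![1, 1, Complex.I, -Complex.I], ![1, -Complex.I, 1, Complex.I],
    ![1, Complex.I, -Complex.I, 1]]

/-- Label of the product of two matrices `sigma`. -/
def sigmaMul : Fin 4 → Fin 4 → Fin 4 :=
  ![![0, 1, 2, 3], ![1, 0, 3, 2], ![2, 3, 0, 1], ![3, 2, 1, 0]]

/-- Sign of the commutation of two matrices `sigma`. -/
def sigmaSign (a b : Fin 4) : ℤ := if a = 0 ∨ b = 0 ∨ a = b then 1 else -1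

theorem sigma_mul (a b : Fin 4) : sigma a * sigma b = sigmaPhase a b • sigma (sigmaMul a b) := by
  fin_cases a <;> fin_cases b <;>
    simp [sigma, sigmaPhase, sigmaMul, Matrix.one_fin_two]

theorem normSq_sigmaPhase (a b : Fin 4) : Complex.normSq (sigmaPhase a b) = 1 := by
  fin_cases a <;> fin_cases b <;> simp [sigmaPhase]

theorem sigma_comm (a b : Fin 4) :
    sigma a * sigma b = (sigmaSign a b : ℂ) • (sigma b * sigma a) := by
  fin_cases a <;> fin_cases b <;>
    simp [sigma, sigmaSign, Matrix.one_fin_two]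

theorem sigma_isHermitian (a : Fin 4) : (sigma a).conjTranspose = sigma a := by
  fin_cases a <;> ext i j <;> fin_cases i <;> fin_cases j <;> simp [sigma, Matrix.one_fin_two]

theorem sigma_mul_self (a : Fin 4) : sigma a * sigma a = 1 := by
  fin_cases a <;> simp [sigma, Matrix.one_fin_two]

theorem trace_sigma_mul (a b : Fin 4) :
    (sigma a * sigma b).trace = if a = b then 2 else 0 := by
  fin_cases a <;> fin_cases b <;>
    simp [sigma, Matrix.one_fin_two, Matrix.trace_fin_two] <;> norm_num

theorem sum_sigma_mul_sigma (i j k l : Fin 2) :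
    ∑ a, sigma a i j * sigma a k l = if i = l ∧ j = k then 2 else 0 := by
  fin_cases i <;> fin_cases j <;> fin_cases k <;> fin_cases l <;>
    simp [sigma, Fin.sum_univ_four, Matrix.one_fin_two] <;> norm_num

theorem sum_sigmaSign_mul (a b : Fin 4) :
    ∑ c, sigmaSign a c * sigmaSign b c = if a = b then 4 else 0 := by
  revert a b; decide

theorem pauli_isHermitian (P : PauliString n) : (pauli P).conjTranspose = pauli P := by
  rw [pauli_eq_tensorQubits, conjTranspose_tensorQubits]
  simp only [sigma_isHermitian]

theorem pauli_mul_self (P : PauliString n) : pauli P * pauli P = 1 := by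
  rw [pauli_eq_tensorQubits, tensorQubits_mul]
  simp only [sigma_mul_self, tensorQubits_one]

theorem pauli_zero : pauli (0 : PauliString n) = 1 := by
  rw [pauli_eq_tensorQubits, ← tensorQubits_one]
  rfl

theorem exists_pauli_mul (P Q : PauliString n) :
    ∃ (c : ℂ) (R : PauliString n), Complex.normSq c = 1 ∧ pauli P * pauli Q = c • pauli R := by
  refine ⟨∏ i, sigmaPhase (P i) (Q i), fun i => sigmaMul (P i) (Q i), ?_, ?_⟩
  · rw [map_prod]
    simp [normSq_sigmaPhase]
  · simp only [pauli_eq_tensorQubits]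
    rw [tensorQubits_mul, ← tensorQubits_smul]
    simp only [sigma_mul]

/-- Sign of the commutation of two Pauli operators. -/
def pauliSign (P Q : PauliString n) : ℤ := ∏ i, sigmaSign (P i) (Q i)

theorem pauli_comm (P Q : PauliString n) :
    pauli P * pauli Q = (pauliSign P Q : ℂ) • (pauli Q * pauli P) := by
  simp only [pauli_eq_tensorQubits, pauliSign]
  rw [tensorQubits_mul, tensorQubits_mul, Int.cast_prod, ← tensorQubits_smul]
  congr 1; funext i
  exact sigma_comm _ _

theorem pauliSign_eq_or (P Q : PauliString n) : pauliSign P Q = 1 ∨ pauliSign P Q = -1 := by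
  rw [← Int.isUnit_iff]
  refine IsUnit.prod_univ_iff.mpr fun i => Int.isUnit_iff.mpr ?_
  unfold sigmaSign
  split_ifs <;> simp

theorem pauliSign_zero (Q : PauliString n) : pauliSign 0 Q = 1 := by
  simp [pauliSign, sigmaSign]

theorem prod_ite_eq_funext {α : Type*} [DecidableEq α] {R : Type*} [CommRing R] (P Q : Fin n → α)
    (c : R) : ∏ i, (if P i = Q i then c else 0) = if P = Q then c ^ n else 0 := by
  rw [Finset.prod_ite_zero]
  simp [funext_iff]

/-- Orthogonality of the commutation characters, which factorizes over qubits. -/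
theorem sum_pauliSign_mul (P P' : PauliString n) :
    ∑ Q, pauliSign P Q * pauliSign P' Q = if P = P' then 4 ^ n else 0 := by
  simp only [pauliSign, ← Finset.prod_mul_distrib]
  rw [← prod_ite_eq_funext]
  simp only [← sum_sigmaSign_mul]
  rw [Finset.prod_univ_sum, Fintype.piFinset_univ]

theorem trace_pauli_mul (P Q : PauliString n) :
    (pauli P * pauli Q).trace = if P = Q then 2 ^ n else 0 := by
  simp only [pauli_eq_tensorQubits]
  rw [tensorQubits_mul, trace_tensorQubits]
  simp only [trace_sigma_mul]
  exact prod_ite_eq_funext _ _ _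

/-- Completeness of the Pauli operators. -/
theorem sum_pauli_mul_pauli (a b c d : Qubits n) :
    ∑ P, pauli P a b * pauli P c d = if a = d ∧ b = c then 2 ^ n else 0 := by
  simp only [pauli, Matrix.of_apply, ← Finset.prod_mul_distrib]
  have h := prod_ite_eq_funext (fun i => (a i, b i)) (fun i => (d i, c i)) (2 : ℂ)
  simp only [Prod.mk.injEq, ← sum_sigma_mul_sigma] at h
  rw [Finset.prod_univ_sum, Fintype.piFinset_univ] at h
  rw [h]
  congr 1
  simp [funext_iff, forall_and]

theorem pauli_expansion (A : Matrix (Qubits n) (Qubits n) ℂ) :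
    (2 : ℂ) ^ n • A = ∑ P, (pauli P * A).trace • pauli P := by
  ext a b
  simp only [Matrix.sum_apply, Matrix.smul_apply, smul_eq_mul, Matrix.trace, Matrix.diag_apply,
    Matrix.mul_apply, Finset.sum_mul]
  rw [Finset.sum_comm]
  simp_rw [Finset.sum_comm (s := Finset.univ (α := PauliString n))]
  have : ∀ x y, ∑ P, pauli P x y * A y x * pauli P a b =
      A y x * if x = b ∧ y = a then 2 ^ n else 0 := by
    intro x y
    rw [← sum_pauli_mul_pauli, Finset.mul_sum]
    exact Finset.sum_congr rfl fun P _ => by ring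
  simp only [this, ite_and, mul_ite, mul_zero]
  simp [mul_comm]

/-- The Pauli twirl, a contraction of the completeness relation. It supplies both the first moment
and the purity identity for stabilizer states. -/
theorem sum_pauli_conj (A : Matrix (Qubits n) (Qubits n) ℂ) :
    ∑ P, pauli P * A * pauli P = ((2 : ℂ) ^ n * A.trace) • 1 := by
  ext a d
  simp only [Matrix.sum_apply, Matrix.smul_apply, smul_eq_mul, Matrix.mul_apply, Finset.sum_mul]
  rw [Finset.sum_comm]
  simp_rw [Finset.sum_comm (s := Finset.univ (α := PauliString n))]
  have : ∀ c b, ∑ P, pauli P a b * A b c * pauli P c d =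
      A b c * if a = d ∧ b = c then 2 ^ n else 0 := by
    intro x y
    rw [← sum_pauli_mul_pauli, Finset.mul_sum]
    exact Finset.sum_congr rfl fun P _ => by ring
  simp only [this, ite_and, mul_ite, mul_zero]
  by_cases h : a = d
  · subst h
    simp [Matrix.trace, Finset.mul_sum, mul_comm]
  · simp [h]

/-- By character orthogonality ∑ (1 - s(P,R))(1 - s(Q,R)) over R equals 4ⁿ, so some term is nonzero.
Such an R connects P to Q by two anticommuting swaps. -/
theorem exists_pauliSign_neg {P Q : PauliString n} (hP : P ≠ 0) (hQ : Q ≠ 0) (hPQ : P ≠ Q) :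
    ∃ R, pauliSign P R = -1 ∧ pauliSign Q R = -1 := by
  have h1 := sum_pauliSign_mul P Q
  have h2 := sum_pauliSign_mul 0 P
  have h3 := sum_pauliSign_mul 0 Q
  have h4 := sum_pauliSign_mul (0 : PauliString n) 0
  simp only [pauliSign_zero, one_mul, if_neg hPQ, if_neg hP.symm, if_neg hQ.symm, if_true]
    at h1 h2 h3 h4
  have h : ∑ R, (1 - pauliSign P R) * (1 - pauliSign Q R) = 4 ^ n := by
    have : ∀ R, (1 - pauliSign P R) * (1 - pauliSign Q R) =
      1 - pauliSign P R - pauliSign Q R + pauliSign P R * pauliSign Q R := fun R => by ring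
    simp only [this, Finset.sum_add_distrib, Finset.sum_sub_distrib, h1, h2, h3, h4]
    ring
  have hne : ∑ R, (1 - pauliSign P R) * (1 - pauliSign Q R) ≠ 0 := by
    rw [h]; positivity
  obtain ⟨R, -, hR⟩ := Finset.exists_ne_zero_of_sum_ne_zero hne
  refine ⟨R, (pauliSign_eq_or P R).resolve_left fun h0 => hR ?_,
    (pauliSign_eq_or Q R).resolve_left fun h0 => hR ?_⟩ <;> simp [h0]

end Pauli

/-! ### Invariance of the stabilizer ensemble, and explicit Clifford unitaries. -/

section CliffordAverage

variable {n : ℕ}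

theorem expVal_add {A : Type} [Fintype A] [DecidableEq A] (B C : Matrix (Qubits n) (Qubits n) ℂ)
    (ψ : Qubits n × A → ℂ) : expVal (B + C) ψ = expVal B ψ + expVal C ψ := by
  simp only [expVal, Matrix.add_kronecker, Matrix.add_mulVec, dotProduct_add]

theorem expVal_smul {A : Type} [Fintype A] [DecidableEq A] (c : ℂ)
    (B : Matrix (Qubits n) (Qubits n) ℂ) (ψ : Qubits n × A → ℂ) :
    expVal (c • B) ψ = c * expVal B ψ := by
  simp only [expVal, Matrix.smul_kronecker, Matrix.smul_mulVec, dotProduct_smul, smul_eq_mul]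

theorem expVal_sum {A : Type} {κ : Type*} [Fintype A] [DecidableEq A] (s : Finset κ)
    (B : κ → Matrix (Qubits n) (Qubits n) ℂ) (ψ : Qubits n × A → ℂ) :
    expVal (∑ k ∈ s, B k) ψ = ∑ k ∈ s, expVal (B k) ψ :=
  map_sum (⟨⟨fun B => expVal B ψ, by simp [expVal]⟩, fun B C => expVal_add B C ψ⟩ :
    Matrix (Qubits n) (Qubits n) ℂ →+ ℂ) B s

theorem expVal_one {A : Type} [Fintype A] [DecidableEq A] {ψ : Qubits n × A → ℂ}
    (hψ : star ψ ⬝ᵥ ψ = 1) : expVal 1 ψ = 1 := by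
  rw [expVal, Matrix.one_kronecker_one, Matrix.one_mulVec, hψ]

theorem expVal_re_eq {A : Type} [Fintype A] [DecidableEq A]
    {H : Matrix (Qubits n) (Qubits n) ℂ} (hH : H.IsHermitian) (ψ : Qubits n × A → ℂ) :
    ((expVal H ψ).re : ℂ) = expVal H ψ :=
  Complex.conj_eq_iff_re.mp
    (star_dotProduct_mulVec_comm (isHermitian_kronecker_one (A := A) hH) ψ ψ).symm

theorem variance_eq {A : Type} [Fintype A] [DecidableEq A]
    {H : Matrix (Qubits n) (Qubits n) ℂ} (hH : H.IsHermitian) (ψ : Qubits n × A → ℂ) :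
    variance H ψ = (expVal (H * H) ψ).re - (expVal H ψ).re ^ 2 := by
  rw [variance, tangent, star_smul, smul_dotProduct, dotProduct_smul, Matrix.star_mulVec,
    (isHermitian_kronecker_one hH).eq, ← Matrix.dotProduct_mulVec, Matrix.mulVec_mulVec,
    ← Matrix.mul_kronecker_mul, one_mul]
  simp [expVal, ← mul_assoc]

theorem expVal_trivialAncilla (A : Matrix (Qubits n) (Qubits n) ℂ) (u : Qubits n → ℂ) :
    expVal A (fun z : Qubits n × Unit => u z.1) = star u ⬝ᵥ A.mulVec u := by
  simp [expVal, dotProduct, Matrix.mulVec, Fintype.sum_prod_type]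

/-- The amplitude `⟨0|U† A U|0⟩`. -/
theorem expVal_stabState (C : Clifford n) (A : Matrix (Qubits n) (Qubits n) ℂ) :
    expVal A (stabState C) =
      (C.unitary.conjTranspose * A * C.unitary) 0 0 := by
  have e := expVal_trivialAncilla A (C.unitary.mulVec (Pi.single 0 1))
  rw [Matrix.star_mulVec, ← Matrix.dotProduct_mulVec, Matrix.mulVec_mulVec,
    Matrix.mulVec_mulVec] at e
  refine e.trans ?_
  simp

theorem Clifford.unitary_spec (C : Clifford n) :
    C.unitary ∈ Matrix.unitaryGroup (Qubits n) ℂ ∧ HasTableau C.unitary C.1 :=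
  C.2.choose_spec

theorem conj_eq_of_hasTableau {U V : Matrix (Qubits n) (Qubits n) ℂ}
    {f : PauliString n → ℤˣ × PauliString n} (hU : HasTableau U f) (hV : HasTableau V f)
    (A : Matrix (Qubits n) (Qubits n) ℂ) :
    U * A * U.conjTranspose = V * A * V.conjTranspose := by
  have h : (2 : ℂ) ^ n • (U * A * U.conjTranspose) = (2 : ℂ) ^ n • (V * A * V.conjTranspose) := by
    rw [← smul_mul_assoc, ← mul_smul_comm, ← smul_mul_assoc, ← mul_smul_comm, pauli_expansion A]
    simp only [Matrix.mul_sum, Matrix.sum_mul, mul_smul_comm, smul_mul_assoc, hU _, hV _]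
  exact smul_right_injective _ (pow_ne_zero n two_ne_zero) h

/-- Paulis span all matrices, so a tableau determines conjugation and its inverse. Hence the unitary
chosen to represent a Clifford element does not affect expectation values. -/
theorem conjTranspose_conj_eq_of_hasTableau {U V : Matrix (Qubits n) (Qubits n) ℂ}
    (hU : U ∈ Matrix.unitaryGroup (Qubits n) ℂ) (hV : V ∈ Matrix.unitaryGroup (Qubits n) ℂ)
    {f : PauliString n → ℤˣ × PauliString n} (hUf : HasTableau U f) (hVf : HasTableau V f)
    (A : Matrix (Qubits n) (Qubits n) ℂ) :
    U.conjTranspose * A * U = V.conjTranspose * A * V := by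
  have hU1 : U * U.conjTranspose = 1 := Matrix.mem_unitaryGroup_iff.mp hU
  have hV1 : V * V.conjTranspose = 1 := Matrix.mem_unitaryGroup_iff.mp hV
  have hV2 : V.conjTranspose * V = 1 := Matrix.mem_unitaryGroup_iff'.mp hV
  have h := conj_eq_of_hasTableau hUf hVf (U.conjTranspose * A * U)
  have h2 : U * (U.conjTranspose * A * U) * U.conjTranspose = A := by
    rw [show U * (U.conjTranspose * A * U) * U.conjTranspose =
      (U * U.conjTranspose) * A * (U * U.conjTranspose) by noncomm_ring, hU1, one_mul, mul_one]
  rw [h2] at h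
  have h3 : V.conjTranspose * A * V = (V.conjTranspose * V) * (U.conjTranspose * A * U) *
      (V.conjTranspose * V) := by
    conv_lhs => rw [h]
    noncomm_ring
  rw [h3, hV2, one_mul, mul_one]

theorem smul_pauli_injective {s t : ℤˣ} {P Q : PauliString n}
    (h : ((s : ℤ) : ℂ) • pauli P = ((t : ℤ) : ℂ) • pauli Q) : s = t ∧ P = Q := by
  have h1 := congrArg (fun A => (A * pauli Q).trace) h
  simp only [smul_mul_assoc, Matrix.trace_smul, trace_pauli_mul, if_true, smul_eq_mul] at h1
  by_cases hPQ : P = Q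
  · refine ⟨?_, hPQ⟩
    rw [if_pos hPQ] at h1
    have := mul_right_cancel₀ (pow_ne_zero n two_ne_zero) h1
    exact Units.ext (by exact_mod_cast this)
  · rw [if_neg hPQ, mul_zero] at h1
    have ht : ((t : ℤ) : ℂ) ≠ 0 := by exact_mod_cast t.ne_zero
    exact absurd h1.symm (mul_ne_zero ht (pow_ne_zero n two_ne_zero))

/-- Left multiplication by a Clifford unitary permutes the Clifford group. -/
theorem exists_equiv_clifford {V : Matrix (Qubits n) (Qubits n) ℂ}
    (hV : V ∈ Matrix.unitaryGroup (Qubits n) ℂ) {g : PauliString n → ℤˣ × PauliString n}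
    (hg : HasTableau V g) : ∃ e : Clifford n ≃ Clifford n, ∀ C A,
      expVal A (stabState (e C)) = expVal (V.conjTranspose * A * V) (stabState C) := by
  have hV2 : V.conjTranspose * V = 1 := Matrix.mem_unitaryGroup_iff'.mp hV
  have htab : ∀ C : Clifford n, HasTableau (V * C.unitary)
      (fun P => ((C.1 P).1 * (g (C.1 P).2).1, (g (C.1 P).2).2)) := by
    intro C P
    have h1 := C.unitary_spec.2 P
    rw [Matrix.conjTranspose_mul, show V * C.unitary * pauli P *
      (C.unitary.conjTranspose * V.conjTranspose) =
      V * (C.unitary * pauli P * C.unitary.conjTranspose) * V.conjTranspose by noncomm_ring, h1,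
      mul_smul_comm, smul_mul_assoc, hg, smul_smul]
    push_cast
    rfl
  have hmem : ∀ C : Clifford n, V * C.unitary ∈ Matrix.unitaryGroup (Qubits n) ℂ := fun C =>
    mul_mem hV C.unitary_spec.1
  let m : Clifford n → Clifford n := fun C => ⟨_, V * C.unitary, hmem C, htab C⟩
  -- The set is finite, so injectivity suffices; it follows by undoing the conjugation by `V` and
  -- using linear independence of the Paulis.
  have hinj : Function.Injective m := by
    intro C D hCD
    have hf := congrArg Subtype.val hCD
    apply Subtype.ext
    funext P
    have h1 := htab C P
    have h2 := htab D P
    have h3 := congrArg (fun p : ℤˣ × PauliString n => ((p.1 : ℤ) : ℂ) • pauli p.2) (congrFun hf P)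
    replace h1 := h1.trans (h3.trans h2.symm)
    rw [Matrix.conjTranspose_mul, Matrix.conjTranspose_mul] at h1
    have h4 := congrArg (fun B => V.conjTranspose * B * V) h1
    have hred : ∀ W : Matrix (Qubits n) (Qubits n) ℂ, V.conjTranspose * (V * W * pauli P *
        (W.conjTranspose * V.conjTranspose)) * V = W * pauli P * W.conjTranspose := by
      intro W
      rw [show V.conjTranspose * (V * W * pauli P * (W.conjTranspose * V.conjTranspose)) * V =
        (V.conjTranspose * V) * W * pauli P * W.conjTranspose * (V.conjTranspose * V) by
          noncomm_ring, hV2, one_mul, mul_one]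
    simp only [hred] at h4
    rw [C.unitary_spec.2 P, D.unitary_spec.2 P] at h4
    obtain ⟨a, b⟩ := smul_pauli_injective h4
    exact Prod.ext a b
  refine ⟨Equiv.ofBijective m (Finite.injective_iff_bijective.mp hinj), fun C A => ?_⟩
  rw [Equiv.ofBijective_apply, expVal_stabState, expVal_stabState,
    conjTranspose_conj_eq_of_hasTableau (m C).unitary_spec.1 (hmem C) (m C).unitary_spec.2
      (htab C), Matrix.conjTranspose_mul]
  noncomm_ring

theorem pauli_mem_unitaryGroup (P : PauliString n) :
    pauli P ∈ Matrix.unitaryGroup (Qubits n) ℂ := by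
  rw [Matrix.mem_unitaryGroup_iff, Matrix.star_eq_conjTranspose, pauli_isHermitian,
    pauli_mul_self]

theorem pauli_conj (P Q : PauliString n) :
    pauli Q * pauli P * pauli Q = (pauliSign P Q : ℂ) • pauli P := by
  rw [mul_assoc, pauli_comm P Q, mul_smul_comm, ← mul_assoc, pauli_mul_self, one_mul]

theorem exists_units_pauliSign (P Q : PauliString n) :
    ∃ s : ℤˣ, (s : ℤ) = pauliSign P Q := by
  rcases pauliSign_eq_or P Q with h | h
  · exact ⟨1, by simp [h]⟩
  · exact ⟨-1, by simp [h]⟩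

theorem exists_hasTableau_pauli (Q : PauliString n) : ∃ g, HasTableau (pauli Q) g := by
  choose s hs using fun P => exists_units_pauliSign P Q
  exact ⟨fun P => (s P, P), fun P => by rw [pauli_isHermitian, pauli_conj, hs]⟩

theorem exists_hasTableau_of_forall {V : Matrix (Qubits n) (Qubits n) ℂ}
    (h : ∀ P, ∃ (s : ℤˣ) (Q : PauliString n),
      V * pauli P * V.conjTranspose = ((s : ℤ) : ℂ) • pauli Q) : ∃ g, HasTableau V g := by
  choose s Q hQ using h
  exact ⟨fun P => (s P, Q P), hQ⟩

/-- A Hermitian multiple of a Pauli operator by a phase is a signed Pauli operator. -/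
theorem exists_sign_of_phase {c : ℂ} (hc : Complex.normSq c = 1) {R : PauliString n}
    (h : (c • pauli R).conjTranspose = c • pauli R) :
    ∃ s : ℤˣ, c • pauli R = ((s : ℤ) : ℂ) • pauli R := by
  have h1 := congrArg (fun A => (A * pauli R).trace) h
  simp only [Matrix.conjTranspose_smul, pauli_isHermitian, smul_mul_assoc, Matrix.trace_smul,
    trace_pauli_mul, if_true, smul_eq_mul] at h1
  have h2 : star c = c := mul_right_cancel₀ (pow_ne_zero n two_ne_zero) h1
  have h3 : c * c = 1 := by
    have := Complex.mul_conj c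
    rw [hc, show (starRingEnd ℂ) c = c from h2] at this
    simpa using this
  rcases mul_self_eq_one_iff.mp h3 with h | h
  · exact ⟨1, by simp [h]⟩
  · exact ⟨-1, by simp [h]⟩

/-- The Clifford unitary `(P + Q) / √2` for anticommuting `P` and `Q`. -/
def pauliSwap (P Q : PauliString n) : Matrix (Qubits n) (Qubits n) ℂ :=
  (((√2)⁻¹ : ℝ) : ℂ) • (pauli P + pauli Q)

theorem inv_sqrt_two_sq : (((√2)⁻¹ : ℝ) : ℂ) * (((√2)⁻¹ : ℝ) : ℂ) = 1 / 2 := by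
  rw [← Complex.ofReal_mul, ← mul_inv, Real.mul_self_sqrt (by norm_num)]; norm_num

theorem pauliSwap_isHermitian (P Q : PauliString n) :
    (pauliSwap P Q).conjTranspose = pauliSwap P Q := by
  rw [pauliSwap, Matrix.conjTranspose_smul, Matrix.conjTranspose_add, pauli_isHermitian,
    pauli_isHermitian, RCLike.star_def, Complex.conj_ofReal]

theorem pauliSwap_conj (P Q : PauliString n) (A : Matrix (Qubits n) (Qubits n) ℂ) :
    pauliSwap P Q * A * pauliSwap P Q =
      (1 / 2 : ℂ) • ((pauli P + pauli Q) * A * (pauli P + pauli Q)) := by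
  rw [pauliSwap, smul_mul_assoc, smul_mul_assoc, mul_smul_comm, smul_smul, inv_sqrt_two_sq]

theorem pauli_anticomm {P Q : PauliString n} (h : pauliSign P Q = -1) :
    pauli P * pauli Q = -(pauli Q * pauli P) := by
  rw [pauli_comm, h]; simp

theorem pauliSwap_mem_unitaryGroup {P Q : PauliString n} (h : pauliSign P Q = -1) :
    pauliSwap P Q ∈ Matrix.unitaryGroup (Qubits n) ℂ := by
  have h2 := pauliSwap_conj P Q 1
  rw [mul_one, mul_one] at h2
  rw [Matrix.mem_unitaryGroup_iff, Matrix.star_eq_conjTranspose, pauliSwap_isHermitian, h2,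
    mul_add, add_mul, add_mul, pauli_mul_self, pauli_mul_self, pauli_anticomm h]
  module

theorem pauliSwap_conj_right {P Q : PauliString n} (h : pauliSign P Q = -1) :
    pauliSwap P Q * pauli Q * pauliSwap P Q = pauli P := by
  rw [pauliSwap_conj]
  have e : (pauli P + pauli Q) * pauli Q * (pauli P + pauli Q) = (2 : ℂ) • pauli P := by
    have : (pauli P + pauli Q) * pauli Q * (pauli P + pauli Q) =
      pauli P * pauli Q * pauli P + pauli P * (pauli Q * pauli Q) + pauli Q * pauli Q * pauli P +
        pauli Q * (pauli Q * pauli Q) := by noncomm_ring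
    rw [this, pauli_anticomm h, neg_mul, mul_assoc, pauli_mul_self, pauli_mul_self]
    rw [mul_one, mul_one, one_mul]
    module
  rw [e, smul_smul]
  norm_num

/-- Moving R to the left past P + Q leaves R(±P ± Q)(P + Q)/2. Equal signs give ±R. Opposite signs
give ±RPQ, a Pauli times a phase, and Hermiticity forces that phase to be a sign. -/
theorem exists_hasTableau_pauliSwap {P Q : PauliString n} (h : pauliSign P Q = -1) :
    ∃ g, HasTableau (pauliSwap P Q) g := by
  have hPQ := pauli_anticomm h
  refine exists_hasTableau_of_forall fun R => ?_
  rw [pauliSwap_isHermitian, pauliSwap_conj]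
  have hP := pauli_comm P R
  have hQ := pauli_comm Q R
  have key : (pauli P + pauli Q) * pauli R * (pauli P + pauli Q) =
      pauli R * (((pauliSign P R : ℂ) • pauli P + (pauliSign Q R : ℂ) • pauli Q) *
        (pauli P + pauli Q)) := by
    rw [add_mul (pauli P), hP, hQ, ← mul_smul_comm, ← mul_smul_comm, ← mul_add, mul_assoc]
  -- the mixed cases give `± i R P Q`-type products
  have mixed : ∀ t : ℂ, Complex.normSq t = 1 →
      (1 / 2 : ℂ) • ((pauli P + pauli Q) * pauli R * (pauli P + pauli Q)) =
        t • (pauli R * (pauli P * pauli Q)) → ∃ (s : ℤˣ) (T : PauliString n),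
      (1 / 2 : ℂ) • ((pauli P + pauli Q) * pauli R * (pauli P + pauli Q)) =
        ((s : ℤ) : ℂ) • pauli T := by
    intro t ht he
    obtain ⟨c₁, T₁, hc₁, h₁⟩ := exists_pauli_mul P Q
    obtain ⟨c₂, T₂, hc₂, h₂⟩ := exists_pauli_mul R T₁
    have he' : t • (pauli R * (pauli P * pauli Q)) = (t * (c₁ * c₂)) • pauli T₂ := by
      rw [h₁, mul_smul_comm, h₂, smul_smul, smul_smul, mul_assoc]
    rw [he'] at he
    have hherm : ((t * (c₁ * c₂)) • pauli T₂).conjTranspose = (t * (c₁ * c₂)) • pauli T₂ := by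
      rw [← he, Matrix.conjTranspose_smul, Matrix.conjTranspose_mul, Matrix.conjTranspose_mul,
        Matrix.conjTranspose_add, pauli_isHermitian, pauli_isHermitian, pauli_isHermitian,
        mul_assoc]
      simp
    obtain ⟨s, hs⟩ := exists_sign_of_phase (by rw [map_mul, map_mul, ht, hc₁, hc₂]; norm_num) hherm
    exact ⟨s, T₂, he.trans hs⟩
  have hsq : (pauli P + pauli Q) * (pauli P + pauli Q) = (2 : ℂ) • 1 := by
    rw [mul_add, add_mul, add_mul, pauli_mul_self, pauli_mul_self, hPQ]
    module
  have hdiff : (pauli P - pauli Q) * (pauli P + pauli Q) = (2 : ℂ) • (pauli P * pauli Q) := by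
    rw [mul_add, sub_mul, sub_mul, pauli_mul_self, pauli_mul_self,
      show pauli Q * pauli P = -(pauli P * pauli Q) by rw [hPQ, neg_neg]]
    module
  rcases pauliSign_eq_or P R with h1 | h1 <;> rcases pauliSign_eq_or Q R with h2 | h2
  · refine ⟨1, R, ?_⟩
    rw [key, h1, h2]
    simp only [Int.cast_one, one_smul, hsq, mul_smul_comm, mul_one, smul_smul, Units.val_one]
    norm_num
  · refine mixed 1 (by simp) ?_
    rw [key, h1, h2]
    simp only [Int.cast_one, Int.cast_neg, one_smul, neg_smul, ← sub_eq_add_neg, hdiff,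
      mul_smul_comm, smul_smul]
    norm_num
  · refine mixed (-1) (by simp) ?_
    rw [key, h1, h2]
    simp only [Int.cast_one, Int.cast_neg, one_smul, neg_smul]
    rw [show -pauli P + pauli Q = -(pauli P - pauli Q) by abel, neg_mul, hdiff]
    simp only [mul_neg, mul_smul_comm, smul_neg, smul_smul]
    norm_num
  · refine ⟨-1, R, ?_⟩
    rw [key, h1, h2]
    simp only [Int.cast_one, Int.cast_neg, one_smul, neg_smul]
    rw [← neg_add, neg_mul, hsq]
    simp only [mul_neg, mul_smul_comm, smul_neg, smul_smul, mul_one, Units.val_neg,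
      Units.val_one, Int.cast_neg, Int.cast_one, neg_smul, one_smul]
    norm_num

end CliffordAverage

/-! ### First and second moments of Pauli expectation values; mean variances. -/

section Averages

variable {n : ℕ}

/-- F sees all expectation values of one state together, so the invariance covers second moments as
well as first. -/
theorem sum_expVal_conj {V : Matrix (Qubits n) (Qubits n) ℂ}
    (hV : V ∈ Matrix.unitaryGroup (Qubits n) ℂ) (hg : ∃ g, HasTableau V g)
    (F : (Matrix (Qubits n) (Qubits n) ℂ → ℂ) → ℝ) :
    ∑ C : Clifford n, F (fun A => expVal (V.conjTranspose * A * V) (stabState C)) =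
      ∑ C : Clifford n, F (fun A => expVal A (stabState C)) := by
  obtain ⟨g, hg⟩ := hg
  obtain ⟨e, he⟩ := exists_equiv_clifford hV hg
  rw [← e.sum_comp (fun C => F (fun A => expVal A (stabState C)))]
  simp only [he]

/-- Correlation of two Pauli expectation values over stabilizer states. -/
def stabCorr (P Q : PauliString n) : ℝ :=
  ∑ C : Clifford n, (expVal (pauli P) (stabState C)).re * (expVal (pauli Q) (stabState C)).re

theorem sum_expVal_stabState (A : Matrix (Qubits n) (Qubits n) ℂ) :
    2 ^ n * ∑ C : Clifford n, (expVal A (stabState C)).re =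
      Fintype.card (Clifford n) * A.trace.re := by
  have h : ∀ Q : PauliString n, ∑ C : Clifford n,
      (expVal (pauli Q * A * pauli Q) (stabState C)).re =
      ∑ C : Clifford n, (expVal A (stabState C)).re := by
    intro Q
    have := sum_expVal_conj (pauli_mem_unitaryGroup Q) (exists_hasTableau_pauli Q)
      (fun E => (E A).re)
    simpa only [pauli_isHermitian] using this
  have h2 := Finset.sum_congr (rfl : (Finset.univ : Finset (PauliString n)) = _) fun Q _ => h Q
  rw [Finset.sum_comm] at h2
  simp only [← Complex.re_sum, ← expVal_sum, sum_pauli_conj, expVal_smul,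
    expVal_one (stabState_unit _), mul_one, Finset.sum_const, Finset.card_univ, nsmul_eq_mul,
    Fintype.card_fun, Fintype.card_fin] at h2 ⊢
  have h3 : ((2 : ℂ) ^ n * A.trace).re = 2 ^ n * A.trace.re := by
    have := Complex.re_ofReal_mul ((2 : ℝ) ^ n) A.trace
    push_cast at this
    exact this
  have h4 : (((4 ^ n : ℕ) : ℝ)) = 2 ^ n * 2 ^ n := by
    rw [← mul_pow]; norm_num
  simp only [Complex.re_sum, h3, h4] at h2 ⊢
  have h5 : (2 : ℝ) ^ n ≠ 0 := by positivity
  apply mul_left_cancel₀ h5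
  linarith

theorem stabCorr_sign (P P' Q : PauliString n) :
    stabCorr P P' = (pauliSign P Q * pauliSign P' Q : ℤ) * stabCorr P P' := by
  have := sum_expVal_conj (pauli_mem_unitaryGroup Q) (exists_hasTableau_pauli Q)
    (fun E => (E (pauli P)).re * (E (pauli P')).re)
  simp only [pauli_isHermitian, pauli_conj, expVal_smul] at this
  conv_lhs => rw [stabCorr, ← this]
  rw [stabCorr, Finset.mul_sum]
  refine Finset.sum_congr rfl fun C _ => ?_
  simp only [← Complex.ofReal_intCast, Complex.re_ofReal_mul]
  push_cast
  ring

/-- Conjugation by Q multiplies the correlation by a product of two characters, and averaging over Q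
kills it. -/
theorem stabCorr_of_ne {P P' : PauliString n} (h : P ≠ P') : stabCorr P P' = 0 := by
  have h1 := Finset.sum_congr (rfl : (Finset.univ : Finset (PauliString n)) = _)
    fun Q _ => stabCorr_sign P P' Q
  rw [← Finset.sum_mul, ← Int.cast_sum, sum_pauliSign_mul, if_neg h] at h1
  simp only [Finset.sum_const, Finset.card_univ, nsmul_eq_mul, Int.cast_zero, zero_mul] at h1
  exact (mul_eq_zero.mp h1).resolve_left (Nat.cast_ne_zero.mpr Fintype.card_ne_zero)

theorem stabCorr_of_anticomm {P Q : PauliString n} (h : pauliSign P Q = -1) :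
    stabCorr P P = stabCorr Q Q := by
  have := sum_expVal_conj (pauliSwap_mem_unitaryGroup h) (exists_hasTableau_pauliSwap h)
    (fun E => (E (pauli Q)).re * (E (pauli Q)).re)
  simp only [pauliSwap_isHermitian, pauliSwap_conj_right h] at this
  exact this

theorem stabCorr_self_eq {P Q : PauliString n} (hP : P ≠ 0) (hQ : Q ≠ 0) :
    stabCorr P P = stabCorr Q Q := by
  by_cases hPQ : P = Q
  · rw [hPQ]
  · obtain ⟨R, h1, h2⟩ := exists_pauliSign_neg hP hQ hPQ
    rw [stabCorr_of_anticomm h1, stabCorr_of_anticomm h2]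

/-- Purity: for a pure state, the twirl of |u⟩⟨u| shows that the squared Pauli expectations sum to
d. -/
theorem sum_stabCorr : ∑ P : PauliString n, stabCorr P P =
    Fintype.card (Clifford n) * 2 ^ n := by
  simp only [stabCorr]
  rw [Finset.sum_comm]
  have h : ∀ C : Clifford n, ∑ P : PauliString n, (expVal (pauli P) (stabState C)).re *
      (expVal (pauli P) (stabState C)).re = 2 ^ n := by
    intro C
    set u : Qubits n → ℂ := fun a => stabState C (a, ()) with hu
    have he : ∀ A, expVal A (stabState C) = star u ⬝ᵥ A.mulVec u :=
      fun A => expVal_trivialAncilla A u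
    have huu : ∑ a, star (u a) * u a = 1 := by
      have := stabState_unit C
      simpa [dotProduct, Fintype.sum_prod_type] using this
    have hc : ∑ P : PauliString n, expVal (pauli P) (stabState C) *
        expVal (pauli P) (stabState C) = 2 ^ n := by
      have h1 : ∀ P : PauliString n, expVal (pauli P) (stabState C) *
          expVal (pauli P) (stabState C) = expVal (pauli P * ketbra u * pauli P) (stabState C) := by
        intro P
        rw [he, he, ← Matrix.mulVec_mulVec, ← Matrix.mulVec_mulVec, ketbra,
          Matrix.vecMulVec_mulVec]
        simp [Matrix.mulVec_smul]
      simp only [h1]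
      rw [← expVal_sum, sum_pauli_conj, expVal_smul, expVal_one (stabState_unit C), mul_one,
        ketbra, Matrix.trace_vecMulVec, dotProduct_comm]
      simp only [dotProduct, Pi.star_apply]
      rw [huu, mul_one]
    have hr : ∀ P : PauliString n, ((expVal (pauli P) (stabState C)).re : ℂ) =
        expVal (pauli P) (stabState C) := fun P => expVal_re_eq (pauli_isHermitian P) _
    apply Complex.ofReal_injective
    rw [Complex.ofReal_sum, Finset.sum_congr rfl fun P _ => by rw [Complex.ofReal_mul, hr], hc]
    push_cast
    rfl
  simp only [h, Finset.sum_const, Finset.card_univ, nsmul_eq_mul]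

/-- With N Clifford elements, the identity takes N of the total Nd and the other d² - 1 Paulis share
the rest equally: N(d - 1)/(d² - 1). -/
theorem stabCorr_self {P : PauliString n} (hP : P ≠ 0) :
    stabCorr P P = Fintype.card (Clifford n) / (2 ^ n + 1) := by
  have h := sum_stabCorr (n := n)
  rw [Finset.sum_eq_add_sum_sdiff_singleton_of_mem (Finset.mem_univ (0 : PauliString n)),
    Finset.sum_congr rfl (g := fun _ => stabCorr P P) (fun Q hQ => by
      rw [stabCorr_self_eq (by simpa using hQ) hP])] at h
  have h0 : stabCorr (0 : PauliString n) 0 = Fintype.card (Clifford n) := by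
    simp only [stabCorr, pauli_zero, expVal_one (stabState_unit _), Complex.one_re, mul_one,
      Finset.sum_const, Finset.card_univ, nsmul_eq_mul]
  have h4 : (4 : ℝ) ^ n = 2 ^ n * 2 ^ n := by
    rw [← mul_pow]; norm_num
  -- A nonidentity Pauli exists only for n > 0, which makes d - 1 cancellable.
  have hn : n ≠ 0 := by
    rintro rfl
    exact hP (Subsingleton.elim _ _)
  have h1 : (1 : ℝ) < 2 ^ n := one_lt_pow₀ (by norm_num) hn
  rw [h0, Finset.sum_const, Finset.card_sdiff_of_subset (by simp), Finset.card_univ,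
    Finset.card_singleton, nsmul_eq_mul, Nat.cast_sub Fintype.card_pos, Fintype.card_fun,
    Fintype.card_fin, Fintype.card_fin] at h
  push_cast at h
  rw [h4] at h
  rw [eq_div_iff (by positivity)]
  have h2 : (2 : ℝ) ^ n - 1 ≠ 0 := by linarith
  apply mul_left_cancel₀ h2
  linarith

theorem trace_pauli {P : PauliString n} (hP : P ≠ 0) : (pauli P).trace = 0 := by
  have := trace_pauli_mul P 0
  rwa [pauli_zero, mul_one, if_neg hP] at this

theorem generator_isHermitian (v : Par n → ℝ) : (generator v).IsHermitian := by
  rw [Matrix.IsHermitian, generator, Matrix.conjTranspose_sum]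
  simp [Matrix.conjTranspose_smul, pauli_isHermitian]

theorem trace_generator (v : Par n → ℝ) : (generator v).trace = 0 := by
  simp only [generator, Matrix.trace_sum, Matrix.trace_smul]
  exact Finset.sum_eq_zero fun k _ => by rw [trace_pauli k.2, smul_zero]

theorem trace_generator_mul_self (v : Par n → ℝ) :
    (generator v * generator v).trace = ((2 ^ n * (v ⬝ᵥ v) : ℝ) : ℂ) := by
  simp only [generator, Finset.sum_mul_sum, Matrix.trace_sum, smul_mul_assoc, mul_smul_comm,
    Matrix.trace_smul, trace_pauli_mul, Subtype.coe_inj, dotProduct, smul_eq_mul, mul_ite,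
    mul_zero, Finset.sum_ite_eq, Finset.mem_univ, if_true]
  push_cast
  rw [Finset.mul_sum]
  exact Finset.sum_congr rfl fun k _ => by ring

theorem expVal_generator {A : Type} [Fintype A] [DecidableEq A] (v : Par n → ℝ)
    (ψ : Qubits n × A → ℂ) :
    (expVal (generator v) ψ).re = ∑ k : Par n, v k * (expVal (pauli k.1) ψ).re := by
  simp only [generator, expVal_sum, expVal_smul, Complex.re_sum, Complex.re_ofReal_mul]

theorem sum_expVal_generator_sq (v : Par n → ℝ) :
    ∑ C : Clifford n, (expVal (generator v) (stabState C)).re ^ 2 =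
      Fintype.card (Clifford n) / (2 ^ n + 1) * (v ⬝ᵥ v) := by
  have h : ∑ C : Clifford n, (expVal (generator v) (stabState C)).re ^ 2 =
      ∑ j : Par n, ∑ k : Par n, v j * v k * stabCorr j.1 k.1 := by
    simp only [expVal_generator, pow_two, Finset.sum_mul_sum]
    simp only [stabCorr, Finset.mul_sum]
    rw [Finset.sum_comm]
    refine Finset.sum_congr rfl fun j _ => ?_
    rw [Finset.sum_comm]
    exact Finset.sum_congr rfl fun k _ => Finset.sum_congr rfl fun C _ => by ring
  rw [h, dotProduct, Finset.mul_sum]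
  refine Finset.sum_congr rfl fun j _ => ?_
  rw [Finset.sum_eq_single j, stabCorr_self j.2]
  · ring
  · intro k _ hk
    rw [stabCorr_of_ne fun h => hk (Subtype.ext h.symm), mul_zero]
  · simp

/-- The mean of ⟨H²⟩ is |v|² and the mean of ⟨H⟩² is |v|²/(d + 1). -/
theorem sum_variance_stabState (v : Par n → ℝ) :
    ∑ C : Clifford n, (Fintype.card (Clifford n) : ℝ)⁻¹ * variance (generator v) (stabState C) =
      2 ^ n / (2 ^ n + 1) * (v ⬝ᵥ v) := by
  have h1 := sum_expVal_stabState (generator v * generator v)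
  rw [trace_generator_mul_self, Complex.ofReal_re] at h1
  have h2 : ∑ C : Clifford n, (expVal (generator v * generator v) (stabState C)).re =
      Fintype.card (Clifford n) * (v ⬝ᵥ v) := by
    apply mul_left_cancel₀ (pow_ne_zero n (two_ne_zero (α := ℝ)))
    linarith
  rw [← Finset.mul_sum]
  simp only [variance_eq (generator_isHermitian v), Finset.sum_sub_distrib, h2,
    sum_expVal_generator_sq]
  have hc : (Fintype.card (Clifford n) : ℝ) ≠ 0 := Nat.cast_ne_zero.mpr Fintype.card_ne_zero
  field_simp
  ring

theorem expVal_meState (A : Matrix (Qubits n) (Qubits n) ℂ) :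
    expVal A (meState n) = A.trace / 2 ^ n := by
  have h : (((Real.sqrt (2 ^ n))⁻¹ : ℝ) : ℂ) * (((Real.sqrt (2 ^ n))⁻¹ : ℝ) : ℂ)
      = ((2 : ℂ) ^ n)⁻¹ := by
    rw [← Complex.ofReal_mul, ← mul_inv, Real.mul_self_sqrt (by positivity)]
    push_cast
    rfl
  simp only [expVal, dotProduct, Matrix.mulVec, Fintype.sum_prod_type, Matrix.kroneckerMap_apply,
    Matrix.one_apply, meState, Pi.star_apply, RCLike.star_def]
  have e : ∀ x y : Qubits n, (starRingEnd ℂ)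
      (if x = y then (((Real.sqrt (2 ^ n))⁻¹ : ℝ) : ℂ) else 0) =
      if x = y then (((Real.sqrt (2 ^ n))⁻¹ : ℝ) : ℂ) else 0 := by
    intro x y
    split_ifs <;> simp
  simp only [e, ite_mul, zero_mul, mul_ite, mul_zero, mul_one, Finset.sum_ite_eq, Finset.mem_univ,
    if_true, Matrix.trace, Matrix.diag_apply, Finset.sum_div]
  refine Finset.sum_congr rfl fun x _ => ?_
  rw [div_eq_mul_inv, ← h]
  ring

theorem variance_meState (v : Par n → ℝ) :
    variance (generator v) (meState n) = v ⬝ᵥ v := by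
  rw [variance_eq (generator_isHermitian v), expVal_meState, expVal_meState, trace_generator,
    trace_generator_mul_self]
  have h : (((2 ^ n * (v ⬝ᵥ v) : ℝ) : ℂ) / 2 ^ n).re = v ⬝ᵥ v := by
    rw [show ((2 : ℂ) ^ n) = ((2 ^ n : ℝ) : ℂ) by push_cast; rfl, ← Complex.ofReal_div,
      Complex.ofReal_re]
    field_simp
  rw [h]
  simp

end Averages

/-! ### Comparison with the optimum. -/

section Main

variable {n : ℕ}

theorem pauli_conjTranspose_mul_self (P : PauliString n) :
    (pauli P).conjTranspose * pauli P = 1 := by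
  rw [pauli_isHermitian, pauli_mul_self]

theorem cfim_isHermitian (E : Protocol n) : E.cfim.IsHermitian := by
  rw [cfim_eq_scoreGram]
  exact scoreGram_isHermitian

/-- No protocol has a weighted mean squared error below `(d² - 1) / 4`. -/
theorem card_div_four_le_wmse (E : Protocol n) (hE : E.cfim.PosDef) :
    (Fintype.card (Par n) : ℝ) / 4 ≤ E.wmse := by
  refine trace_inv_ge hE fun k => ?_
  rw [cfim_eq_scoreGram]
  have := scoreGram_diag_le (pr := E.prob 0) (a := fun k : Par n => E.score (pauli k.1))
    (b := fun k : Par n => E.scoreBound (pauli k.1)) (prob_nonneg E)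
    (fun k z => score_sq_le E (pauli k.1) z) (fun k z => scoreBound_nonneg E (pauli k.1) z)
    (hasSum_scoreBound E (pauli_conjTranspose_mul_self k.1))
  linarith

/-- The given protocol shows that the infimum is over a nonempty set; the real `sInf` of the empty
set would be 0. -/
theorem card_div_four_le_optimalWMSE (E : Protocol n) (hE : E.cfim.PosDef) :
    (Fintype.card (Par n) : ℝ) / 4 ≤ optimalWMSE n := by
  refine le_csInf ⟨_, E, hE, rfl⟩ ?_
  rintro _ ⟨E', hE', rfl⟩
  exact card_div_four_le_wmse E' hE'

/-- A protocol whose Fisher information matrix is at least `c` is optimal up to a factor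
`4 / c`. -/
theorem wmse_le_of_le_cfim (E : Protocol n) {c : ℝ} (hc : 0 < c)
    (h : ∀ v : Par n → ℝ, c * (v ⬝ᵥ v) ≤ v ⬝ᵥ E.cfim.mulVec v) :
    E.cfim.PosDef ∧ E.wmse ≤ 4 / c * optimalWMSE n := by
  have hE := posDef_of_le (cfim_isHermitian E) hc h
  refine ⟨hE, (trace_inv_le (cfim_isHermitian E) hc h).trans ?_⟩
  have h1 := mul_le_mul_of_nonneg_left (card_div_four_le_optimalWMSE E hE)
    (show 0 ≤ 4 / c by positivity)
  refine le_trans (le_of_eq ?_) h1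
  field_simp

theorem dotProduct_self_le_cfim_meProtocol {X : Type} (M : POVM (Qubits n × Qubits n) X)
    (hM : M.IsThreeDesign) (v : Par n → ℝ) :
    1 * (v ⬝ᵥ v) ≤ v ⬝ᵥ (meProtocol n M).cfim.mulVec v := by
  let : Fintype (meProtocol n M).ι := inferInstanceAs (Fintype Unit)
  have h := le_cfim_of_design (meProtocol n M) (fun _ => hM.hasDesignMoments)
    (fun k => pauli_conjTranspose_mul_self k.1) v (generator_isHermitian v)
  refine le_trans (le_of_eq ?_) h
  rw [← variance_meState v]
  exact (Fintype.sum_unique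
    (fun _ : Unit => (1 : ℝ) * variance (generator v) (meState n))).symm

theorem le_cfim_stabProtocol {X : Type} (M : POVM (Qubits n) X)
    (hM : M.IsThreeDesign) (v : Par n → ℝ) :
    2 ^ n / (2 ^ n + 1) * (v ⬝ᵥ v) ≤ v ⬝ᵥ (stabProtocol n M).cfim.mulVec v := by
  let : Fintype (stabProtocol n M).ι := inferInstanceAs (Fintype (Clifford n))
  have h := le_cfim_of_design (stabProtocol n M)
    (fun _ => hM.hasDesignMoments.withTrivialAncilla)
    (fun k => pauli_conjTranspose_mul_self k.1) v (generator_isHermitian v)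
  rw [← sum_variance_stabState v]
  exact h

end Main

end HamEst

end

theorem mainTheorem6 (n : ℕ) :
    (∀ (X : Type) (M : HamEst.POVM (HamEst.Qubits n × HamEst.Qubits n) X), M.IsThreeDesign →
      (HamEst.meProtocol n M).cfim.PosDef ∧
      (HamEst.meProtocol n M).wmse ≤ 4 * HamEst.optimalWMSE n) ∧
    (∀ (X : Type) (M : HamEst.POVM (HamEst.Qubits n) X), M.IsThreeDesign →
      (HamEst.stabProtocol n M).cfim.PosDef ∧
      (HamEst.stabProtocol n M).wmse ≤
        4 * ((2 : ℝ) ^ n + 1) / (2 : ℝ) ^ n * HamEst.optimalWMSE n) := by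
  refine ⟨fun X M hM => ?_, fun X M hM => ?_⟩
  · have h := HamEst.wmse_le_of_le_cfim _ one_pos (HamEst.dotProduct_self_le_cfim_meProtocol M hM)
    rwa [div_one] at h
  · have h := HamEst.wmse_le_of_le_cfim _ (by positivity) (HamEst.le_cfim_stabProtocol M hM)
    rwa [div_div_eq_mul_div] at h
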